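/- **Theorem (Poincaré–Dulac theorem for flat logarithmic connections).** Let $0\le k\le m$, let $t_1,\dots,t_m$ be the coordinates on $(\mathbb C^m,0)$, and let $\Sigma=\{t_1\cdots t_k=0\}$ be the coordinate normal crossing (for $k=0$ this is the empty set). Let $A_1,\dots,A_k\in \mathrm{Mat}_n(\mathbb C)$ be constant diagonal matrices, and let $$\Omega_0=\sum_{s=1}^k A_s\,\frac{dt_s}{t_s}=\mathrm{diag}\{\alpha_1,\dots,\alpha_n\},\qquad \alpha_i=\sum_{s=1}^k a_i^s\,\frac{dt_s}{t_s},$$ be the corresponding closed diagonal logarithmic matrix form. Assume that $\Omega_0$ is non-resonant: for no pair $i\neq j$ are all the residues $a_i^s-a_j^s$, $s=1,\dots,k$, of the difference $\alpha_i-\alpha_j$ integers. Let $\Omega=\Omega_0+\Theta$, where $\Theta$ is an $n\times n$ matrix of 1-forms holomorphic in a neighbourhood of the origin, and suppose that $\Omega$ is flat, i.e. $d\Omega=\Omega\wedge\Omega$ outside $\Sigma$ near the origin (where $(\Omega\wedge\Omega)_{ij}=\sum_l\omega_{il}\wedge\omega_{lj}$). Then $\Omega$ is holomorphically gauge equivalent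 to $\Omega_0$: there are a neighbourhood $V$ of the origin and a holomorphic map $H:V\to \mathrm{GL}(n,\mathbb C)$ such that $$\Omega_0=dH\cdot H^{-1}+H\,\Omega\,H^{-1}\qquad\text{on } V\setminus\Sigma .$$ -/

import Mathlib

open Filter Topology

noncomputable section

namespace LogConn

/-- Differential `p`-forms on `ℂ^m` with (complex-linear) scalar values. -/
abbrev Form (m p : ℕ) : Type :=
  (Fin m → ℂ) → (Fin m → ℂ) [⋀^Fin p]→L[ℂ] ℂ

/-- `n × n` matrices of scalar 1-forms. -/
abbrev MatForm (m n : ℕ) : Type :=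
  Matrix (Fin n) (Fin n) (Form m 1)

/-- The value `ω_t(v)` of a 1-form. -/
def Form.val {m : ℕ} (ω : Form m 1) (t v : Fin m → ℂ) : ℂ :=
  ω t fun _ => v

/-- The numerical matrix obtained by evaluating all entries of `Ω` at the point `t` and
the vector `v`. -/
def MatForm.val {m n : ℕ} (Ω : MatForm m n) (t v : Fin m → ℂ) : Matrix (Fin n) (Fin n) ℂ :=
  Matrix.of fun i j => (Ω i j).val t v

/-- The 1-form given by a field of linear functionals. -/
def oneForm {m : ℕ} (ℓ : (Fin m → ℂ) → (Fin m → ℂ) →L[ℂ] ℂ) : Form m 1 :=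
  fun t => ContinuousAlternatingMap.ofSubsingleton ℂ (Fin m → ℂ) ℂ (0 : Fin 1) (ℓ t)

/-- The differential `dh` of a function. -/
def dfun {m : ℕ} (h : (Fin m → ℂ) → ℂ) : Form m 1 :=
  oneForm fun t => fderiv ℂ h t

/-- The entrywise differential `dH` of a matrix function. -/
def dmat {m n : ℕ} (H : (Fin m → ℂ) → Matrix (Fin n) (Fin n) ℂ) : MatForm m n :=
  Matrix.of fun i j => dfun fun t => H t i j

/-- The wedge product of two 1-forms,
`(α ∧ β)(v, w) = α(v) β(w) - α(w) β(v)`, see `wedge_apply`. -/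
def wedge {m : ℕ} (α β : Form m 1) : Form m 2 := fun t =>
  ContinuousAlternatingMap.alternatizeUncurryFin
    (((ContinuousAlternatingMap.ofSubsingleton ℂ (Fin m → ℂ) ℂ (0 : Fin 1)).symm
      (α t)).smulRight (β t))

theorem wedge_apply {m : ℕ} (α β : Form m 1) (t v w : Fin m → ℂ) :
    wedge α β t ![v, w] = α.val t v * β.val t w - α.val t w * β.val t v := by
  have h0 : Fin.removeNth (0 : Fin 2) ![v, w] = fun _ => w := by
    ext i; fin_cases i; rfl
  have h1 : Fin.removeNth (1 : Fin 2) ![v, w] = fun _ => v := by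
    ext i; fin_cases i; rfl
  rw [wedge, ContinuousAlternatingMap.alternatizeUncurryFin_apply, Fin.sum_univ_two, h0, h1]
  simp [Form.val, sub_eq_add_neg]

/-- The wedge product of matrix 1-forms, with entries `∑ l, ω_{il} ∧ θ_{lj}`. -/
def matWedge {m n : ℕ} (Ω Θ : MatForm m n) : Matrix (Fin n) (Fin n) (Form m 2) :=
  Matrix.of fun i j => ∑ l, wedge (Ω i l) (Θ l j)

/-- The normal crossing `{t_1 ⋯ t_k = 0}` in `ℂ^m`. -/
def cross {m k : ℕ} (hk : k ≤ m) : Set (Fin m → ℂ) :=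
  {t | ∏ s : Fin k, t (Fin.castLE hk s) = 0}

/-- The form `dt_s / t_s`, for `s` one of the first `k` coordinates (only its values off
`{t_s = 0}` are meaningful). -/
def dlog {m k : ℕ} (hk : k ≤ m) (s : Fin k) : Form m 1 :=
  oneForm fun t => (t (Fin.castLE hk s))⁻¹ • ContinuousLinearMap.proj (Fin.castLE hk s)

/-- The matrix form `Ω₀ = ∑_{s=1}^k A_s dt_s / t_s` with constant residue matrices `A_s`. -/
def euler {m k n : ℕ} (hk : k ≤ m) (A : Fin k → Matrix (Fin n) (Fin n) ℂ) : MatForm m n :=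
  Matrix.of fun i j => ∑ s, A s i j • dlog hk s

/-- Non-resonance of the diagonal form `diag(α_1, …, α_n) = ∑ A_s dt_s / t_s`: no difference
`α_i - α_j`, `i ≠ j`, has all its residues (along `t_1 = 0, …, t_k = 0`) integer. -/
def NonResonant {k n : ℕ} (A : Fin k → Matrix (Fin n) (Fin n) ℂ) : Prop :=
  ∀ i j, i ≠ j → ¬ ∀ s, ∃ N : ℤ, A s i i - A s j j = N

/-- The germ at the origin of a matrix 1-form is holomorphic. -/
def MatForm.Holomorphic {m n : ℕ} (Θ : MatForm m n) : Prop :=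
  ∀ i j, AnalyticAt ℂ (Θ i j) 0

/-- Flatness `dΩ = Ω ∧ Ω` in a neighbourhood of the origin, off the crossing. -/
def Flat {m k n : ℕ} (hk : k ≤ m) (Ω : MatForm m n) : Prop :=
  ∀ᶠ t in 𝓝[(cross hk)ᶜ] 0, ∀ i j, extDeriv (Ω i j) t = matWedge Ω Ω i j t

/-- Holomorphic gauge equivalence at the origin of two matrix forms with poles on the
crossing: `Ω' = dH ⬝ H⁻¹ + H Ω H⁻¹` off the crossing, with `H` holomorphic and invertible in
a full neighbourhood of the origin. -/
def GaugeEquiv {m k n : ℕ} (hk : k ≤ m) (Ω Ω' : MatForm m n) : Prop :=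
  ∃ H : (Fin m → ℂ) → Matrix (Fin n) (Fin n) ℂ,
    (∀ i j, AnalyticAt ℂ (fun t => H t i j) 0) ∧
    (∀ᶠ t in 𝓝 0, IsUnit (H t)) ∧
    ∀ᶠ t in 𝓝[(cross hk)ᶜ] 0, ∀ v,
      Ω'.val t v = (dmat H).val t v * (H t)⁻¹ + H t * Ω.val t v * (H t)⁻¹

end LogConn

end

/-!
Write `Ω = ∑ Ω_s dt_s` and `B_s = t_s Ω_s`. This matrix is holomorphic for every coordinate `t_s`,
also for those without a pole, where the residue is `0`; so all coordinates are treated alike.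
With the logarithmic derivations `δ_s = t_s ∂/∂t_s` and `A_s` the residues, flatness reads
`δ_a B_b - δ_b B_a = B_a B_b - B_b B_a` (`formal_flatness`), and a gauge transformation to `Ω₀` is
an invertible `H` with `δ_a H = A_a H - H B_a` for all `a`.

By non-resonance, `p ≠ a_i - a_j` for all multi-indices `p ≠ 0` and all `i`, `j`, where
`a_i ∈ ℂ^m` is the vector of residues of `α_i`. These are countably many conditions, so there are
positive real weights `w` with `⟨w, p - (a_i - a_j)⟩ ≠ 0` for all of them (`exists_pos_weights`).
Positivity of the weights excludes small divisors: these numbers are bounded away from `0`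
(`exists_divisor_lower_bound`). Therefore the single equation
`∑ w_s (δ_s H - A_s H + H B_s) = 0`, whose linear part is diagonal on monomials with exactly these
eigenvalues, has a solution with `H(0) = 1`: it is a triangular recursion for the coefficients
of `H` (`exists_formal_solution`), and it converges because `∑ w_s (B_s - A_s)` vanishes at the
origin and so has small norm on a small polydisc (`exists_summable_of_convolution_bound`).

Flatness turns this one equation into all of them. The defects `Ψ_a = δ_a H - A_a H + H B_a`
satisfy `∑ w_b δ_b Ψ_a = A_w Ψ_a - Ψ_a B_w` with `A_w = ∑ w_b A_b`, `B_w = ∑ w_b B_b`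
(`weighted_derivation_defect`). This is again the triangular recursion, now with vanishing constant
term, hence `Ψ_a = 0` (`formal_solution_eq_zero`).

The algebra takes place in Mathlib's ring of formal power series. The predicate `HasExpansion`
relates a germ of function to its power series, compatibly with sums, products and the `δ_s`.
-/

namespace LogConn

open MvPowerSeries

/-! ### Convergent multi-index expansions -/

section Expansion

variable {ι : Type*}

/-- Absolute convergence of `F` on the closed polydisc of radius `r`. -/
def ConvergesAt (F : MvPowerSeries ι ℂ) (r : ℝ) : Prop :=
  Summable fun p => ‖coeff p F‖ * r ^ p.degree

theorem ConvergesAt.mono {F : MvPowerSeries ι ℂ} {r ρ : ℝ} (h : ConvergesAt F r)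
    (hρ : 0 ≤ ρ) (hr : ρ ≤ r) : ConvergesAt F ρ :=
  Summable.of_nonneg_of_le (fun _ => by positivity) (fun _ => by gcongr) h

variable [Fintype ι]

/-- The monomial function `t ↦ ∏ t_s ^ p_s`. -/
def monom (p : ι →₀ ℕ) (t : ι → ℂ) : ℂ := ∏ s, t s ^ p s

theorem monom_add (p q : ι →₀ ℕ) (t : ι → ℂ) : monom (p + q) t = monom p t * monom q t := by
  simp [monom, pow_add, Finset.prod_mul_distrib]

theorem monom_zero (t : ι → ℂ) : monom 0 t = 1 := by simp [monom]

theorem monom_single [DecidableEq ι] (s : ι) (t : ι → ℂ) :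
    monom (Finsupp.single s 1) t = t s := by
  rw [monom, Finset.prod_eq_single s] <;> simp +contextual [eq_comm]

theorem norm_monom_le (p : ι →₀ ℕ) {t : ι → ℂ} {r : ℝ} (ht : ‖t‖ ≤ r) :
    ‖monom p t‖ ≤ r ^ p.degree := by
  rw [monom, norm_prod, Finsupp.degree_eq_sum, ← Finset.prod_pow_eq_pow_sum]
  refine Finset.prod_le_prod (fun _ _ => norm_nonneg _) fun s _ => ?_
  rw [norm_pow]
  exact pow_le_pow_left₀ (norm_nonneg _) ((norm_le_pi_norm t s).trans ht) _

theorem ConvergesAt.summable_norm {F : MvPowerSeries ι ℂ} {r : ℝ} (h : ConvergesAt F r)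
    {t : ι → ℂ} (ht : ‖t‖ ≤ r) : Summable fun p => ‖coeff p F * monom p t‖ := by
  refine Summable.of_nonneg_of_le (fun _ => by positivity) (fun p => ?_) h
  rw [norm_mul]
  gcongr
  exact norm_monom_le p ht

/-- `F` converges absolutely to `f` on some closed polydisc around the origin. -/
def HasExpansion (f : (ι → ℂ) → ℂ) (F : MvPowerSeries ι ℂ) : Prop :=
  ∃ r > 0, ConvergesAt F r ∧ ∀ t, ‖t‖ ≤ r → HasSum (fun p => coeff p F * monom p t) (f t)

theorem ConvergesAt.hasExpansion {F : MvPowerSeries ι ℂ} {r : ℝ} (hr : 0 < r)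
    (h : ConvergesAt F r) : HasExpansion (fun t => ∑' p, coeff p F * monom p t) F :=
  ⟨r, hr, h, fun _ ht => (h.summable_norm ht).of_norm.hasSum⟩

/-- The expansion is valid on all sufficiently small polydiscs, so that finitely many expansions
share a radius. -/
theorem HasExpansion.eventually {f : (ι → ℂ) → ℂ} {F : MvPowerSeries ι ℂ}
    (h : HasExpansion f F) : ∀ᶠ r in 𝓝[>] (0 : ℝ),
      ConvergesAt F r ∧ ∀ t, ‖t‖ ≤ r → HasSum (fun p => coeff p F * monom p t) (f t) := by
  obtain ⟨r, hr, h1, h2⟩ := h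
  filter_upwards [Ioc_mem_nhdsGT hr] with ρ hρ
  exact ⟨h1.mono hρ.1.le hρ.2, fun t ht => h2 t (ht.trans hρ.2)⟩

theorem HasExpansion.of_eventually {f : (ι → ℂ) → ℂ} {F : MvPowerSeries ι ℂ}
    (h : ∀ᶠ r in 𝓝[>] (0 : ℝ),
      ConvergesAt F r ∧ ∀ t, ‖t‖ ≤ r → HasSum (fun p => coeff p F * monom p t) (f t)) :
    HasExpansion f F := by
  obtain ⟨r, h, hr⟩ := (h.and self_mem_nhdsWithin).exists
  exact ⟨r, hr, h⟩

theorem eventually_nhdsGT_forall_norm_le {E : Type*} [SeminormedAddCommGroup E] {P : E → Prop}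
    (h : ∀ᶠ t in 𝓝 (0 : E), P t) : ∀ᶠ r in 𝓝[>] (0 : ℝ), ∀ t, ‖t‖ ≤ r → P t := by
  obtain ⟨ε, hε, h⟩ := Metric.eventually_nhds_iff.1 h
  filter_upwards [Ioo_mem_nhdsGT hε] with ρ hρ t ht
  exact h (by simpa using ht.trans_lt hρ.2)

theorem HasExpansion.congr {f g : (ι → ℂ) → ℂ} {F : MvPowerSeries ι ℂ}
    (h : HasExpansion f F) (hfg : f =ᶠ[𝓝 0] g) : HasExpansion g F := by
  refine .of_eventually ?_
  filter_upwards [h.eventually, eventually_nhdsGT_forall_norm_le hfg] with r h1 h2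
  exact ⟨h1.1, fun t ht => h2 t ht ▸ h1.2 t ht⟩

theorem HasExpansion.add {f g : (ι → ℂ) → ℂ} {F G : MvPowerSeries ι ℂ}
    (hf : HasExpansion f F) (hg : HasExpansion g G) :
    HasExpansion (fun t => f t + g t) (F + G) := by
  refine .of_eventually ?_
  filter_upwards [hf.eventually, hg.eventually, self_mem_nhdsWithin] with r h1 h2 hr
  have hr : 0 < r := hr
  refine ⟨Summable.of_nonneg_of_le (fun _ => by positivity) (fun p => ?_) (h1.1.add h2.1),
    fun t ht => ?_⟩
  · rw [← add_mul, map_add]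
    gcongr
    exact norm_add_le _ _
  · simpa [add_mul] using (h1.2 t ht).add (h2.2 t ht)

theorem HasExpansion.neg {f : (ι → ℂ) → ℂ} {F : MvPowerSeries ι ℂ}
    (hf : HasExpansion f F) : HasExpansion (fun t => - f t) (-F) := by
  obtain ⟨r, hr, h1, h2⟩ := hf
  refine ⟨r, hr, by simpa [ConvergesAt] using h1, fun t ht => ?_⟩
  simpa using (h2 t ht).neg

theorem HasExpansion.sub {f g : (ι → ℂ) → ℂ} {F G : MvPowerSeries ι ℂ}
    (hf : HasExpansion f F) (hg : HasExpansion g G) :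
    HasExpansion (fun t => f t - g t) (F - G) := by
  simpa [sub_eq_add_neg] using hf.add hg.neg

theorem hasExpansion_const (c : ℂ) : HasExpansion (fun _ : ι → ℂ => c) (C c) := by
  classical
  refine ⟨1, one_pos, ?_, fun t _ => ?_⟩
  · refine summable_of_ne_finset_zero (s := {0}) fun p hp => ?_
    simp_all [coeff_C]
  · have := hasSum_single (f := fun p => coeff p (C c : MvPowerSeries ι ℂ) * monom p t) 0
      (fun p hp => by simp [coeff_C, hp])
    simpa [monom_zero] using this

theorem hasExpansion_coord (s : ι) : HasExpansion (fun t : ι → ℂ => t s) (X s) := by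
  classical
  refine ⟨1, one_pos, ?_, fun t _ => ?_⟩
  · refine summable_of_ne_finset_zero (s := {Finsupp.single s 1}) fun p hp => ?_
    simp_all [coeff_X]
  · have := hasSum_single (f := fun p => coeff p (X s : MvPowerSeries ι ℂ) * monom p t)
      (Finsupp.single s 1) (fun p hp => by simp [coeff_X, hp])
    simpa [monom_single] using this

theorem HasExpansion.mul {f g : (ι → ℂ) → ℂ} {F G : MvPowerSeries ι ℂ}
    (hf : HasExpansion f F) (hg : HasExpansion g G) :
    HasExpansion (fun t => f t * g t) (F * G) := by
  classical
  refine .of_eventually ?_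
  filter_upwards [hf.eventually, hg.eventually, self_mem_nhdsWithin] with r h1 h2 hr
  have hr : 0 < r := hr
  refine ⟨?_, fun t ht => ?_⟩
  · have hF : Summable fun p => ‖coeff p F‖ * r ^ p.degree := h1.1
    have hG : Summable fun p => ‖coeff p G‖ * r ^ p.degree := h2.1
    have h3 := summable_sum_mul_antidiagonal_of_summable_mul
      (f := fun p => ‖coeff p F‖ * r ^ p.degree) (g := fun p => ‖coeff p G‖ * r ^ p.degree)
      (hF.mul_of_nonneg hG (fun p => by dsimp; positivity) (fun p => by dsimp; positivity))
    refine Summable.of_nonneg_of_le (fun _ => by positivity) (fun p => ?_) h3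
    rw [coeff_mul]
    calc _ ≤ (∑ x ∈ Finset.HasAntidiagonal.antidiagonal p, ‖coeff x.1 F * coeff x.2 G‖) *
            r ^ p.degree := by
          gcongr; exact norm_sum_le _ _
      _ = _ := by
          rw [Finset.sum_mul]
          refine Finset.sum_congr rfl fun x hx => ?_
          rw [← Finset.HasAntidiagonal.mem_antidiagonal.1 hx, map_add, pow_add, norm_mul]
          ring
  · have hF := h1.1.summable_norm ht
    have hG := h2.1.summable_norm ht
    have h3 := summable_mul_of_summable_norm hF hG
    have h4 := (summable_sum_mul_antidiagonal_of_summable_mul (f := fun p => coeff p F * monom p t)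
      (g := fun p => coeff p G * monom p t) h3).hasSum
    rw [← Summable.tsum_mul_tsum_eq_tsum_sum_antidiagonal (f := fun p => coeff p F * monom p t)
      (g := fun p => coeff p G * monom p t) hF.of_norm hG.of_norm h3,
      (h1.2 t ht).tsum_eq, (h2.2 t ht).tsum_eq] at h4
    convert! h4 using 2 with p
    rw [coeff_mul, Finset.sum_mul]
    refine Finset.sum_congr rfl fun x hx => ?_
    rw [← Finset.HasAntidiagonal.mem_antidiagonal.1 hx, monom_add]
    ring

theorem HasExpansion.sum {κ : Type*} (S : Finset κ) {f : κ → (ι → ℂ) → ℂ}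
    {F : κ → MvPowerSeries ι ℂ} (h : ∀ k ∈ S, HasExpansion (f k) (F k)) :
    HasExpansion (fun t => ∑ k ∈ S, f k t) (∑ k ∈ S, F k) := by
  classical
  induction S using Finset.induction_on with
  | empty => simpa using hasExpansion_const (ι := ι) 0
  | insert a S ha ih =>
    simp only [Finset.sum_insert ha]
    exact (h a (by simp)).add (ih fun k hk => h k (by simp [hk]))

theorem HasExpansion.apply_zero {f : (ι → ℂ) → ℂ} {F : MvPowerSeries ι ℂ}
    (h : HasExpansion f F) : f 0 = coeff 0 F := by
  classical
  obtain ⟨r, hr, -, h⟩ := h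
  refine (h 0 (by simpa using hr.le)).unique ?_
  have := hasSum_single (f := fun p => coeff p F * monom p 0) 0 (fun p hp => by
    obtain ⟨s, hs⟩ := Finsupp.ne_iff.1 hp
    rw [monom, Finset.prod_eq_zero (Finset.mem_univ s) (by simpa using hs), mul_zero])
  simpa [monom_zero] using this

end Expansion

section Analytic

variable {ι : Type*}

/-! ### Logarithmic derivatives -/

/-- The logarithmic derivation `t_s ∂/∂t_s` of formal power series. -/
noncomputable def eulerDeriv (s : ι) : Derivation ℂ (MvPowerSeries ι ℂ) (MvPowerSeries ι ℂ) :=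
  (X s : MvPowerSeries ι ℂ) • pderiv ℂ s

theorem coeff_eulerDeriv (s : ι) (F : MvPowerSeries ι ℂ) (p : ι →₀ ℕ) :
    coeff p (eulerDeriv s F) = p s * coeff p F := by
  classical
  rw [eulerDeriv, Derivation.smul_apply, smul_eq_mul, X, coeff_monomial_mul]
  by_cases h : Finsupp.single s 1 ≤ p
  · obtain ⟨q, rfl⟩ := exists_add_of_le h
    rw [if_pos h, coeff_pderiv]
    simp [add_comm]
    ring
  · rw [if_neg h]
    have : p s = 0 := by
      by_contra h'
      exact h (by simpa using Nat.one_le_iff_ne_zero.2 h')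
    simp [this]

theorem eulerDeriv_comm (a b : ι) (F : MvPowerSeries ι ℂ) :
    eulerDeriv a (eulerDeriv b F) = eulerDeriv b (eulerDeriv a F) := by
  ext p
  simp only [coeff_eulerDeriv]
  ring

/-! ### Expansions and analytic functions -/

/-- The exponent of the monomial that a word of letters spells. -/
noncomputable def content [DecidableEq ι] (x : Σ d, Fin d → ι) : ι →₀ ℕ :=
  ∑ i, Finsupp.single (x.2 i) 1

theorem degree_content [DecidableEq ι] (x : Σ d, Fin d → ι) : (content x).degree = x.1 := by
  simp [content]

variable [Fintype ι]

/-- A monomial of degree `d` is spelled by a word of `d` coordinates. -/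
theorem exists_word (p : ι →₀ ℕ) {d : ℕ} (hd : p.degree = d) :
    ∃ w : Fin d → ι, ∀ t : ι → ℂ, ∏ i, t (w i) = monom p t := by
  have hl : p.toMultiset.toList.length = d := by
    rw [Multiset.length_toList, Finsupp.card_toMultiset, ← hd]
    rfl
  subst hl
  refine ⟨fun i => p.toMultiset.toList.get i, fun t => ?_⟩
  rw [← List.prod_ofFn, ← Function.comp_def t, ← List.map_ofFn, List.ofFn_get,
    ← Multiset.prod_coe, ← Multiset.map_coe, Multiset.coe_toList, Finsupp.toMultiset_map,
    Finsupp.prod_toMultiset, Finsupp.prod_mapDomain_index (by simp) (by simp [pow_add]),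
    monom, Finsupp.prod_fintype _ _ (by simp)]

/-- The exponents of total degree `d`. -/
noncomputable def degreeFinset (ι : Type*) [Fintype ι] (d : ℕ) : Finset (ι →₀ ℕ) :=
  (Finsupp.finite_of_degree_eq (σ := ι) d).toFinset

theorem mem_degreeFinset {d : ℕ} {p : ι →₀ ℕ} : p ∈ degreeFinset ι d ↔ p.degree = d := by
  simp [degreeFinset]

/-- A multilinear map whose restriction to the diagonal is `monom p`, for `p` of degree `d`. -/
noncomputable def monomMultilinear (d : ℕ) (p : degreeFinset ι d) : (ι → ℂ) [×d]→L[ℂ] ℂ :=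
  (ContinuousMultilinearMap.mkPiAlgebraFin ℂ d ℂ).compContinuousLinearMap fun i =>
    ContinuousLinearMap.proj ((exists_word p.1 (mem_degreeFinset.1 p.2)).choose i)

theorem monomMultilinear_apply (d : ℕ) (p : degreeFinset ι d) (t : ι → ℂ) :
    (monomMultilinear d p fun _ => t) = monom p t := by
  rw [← (exists_word p.1 (mem_degreeFinset.1 p.2)).choose_spec t]
  simp [monomMultilinear, List.prod_ofFn]

theorem norm_monomMultilinear_le (d : ℕ) (p : degreeFinset ι d) :
    ‖monomMultilinear d p‖ ≤ 1 := by
  refine ContinuousMultilinearMap.opNorm_le_bound zero_le_one fun v => ?_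
  simp only [monomMultilinear, ContinuousMultilinearMap.compContinuousLinearMap_apply,
    ContinuousMultilinearMap.mkPiAlgebraFin_apply, List.prod_ofFn, norm_prod, one_mul]
  exact Finset.prod_le_prod (fun _ _ => norm_nonneg _) fun i _ => norm_le_pi_norm (v i) _

/-- The formal multilinear series whose `d`-th term collects the monomials of degree `d`. -/
noncomputable def toMultilinear (F : MvPowerSeries ι ℂ) : FormalMultilinearSeries ℂ (ι → ℂ) ℂ :=
  fun d => ∑ p : degreeFinset ι d, coeff p.1 F • monomMultilinear d p

theorem toMultilinear_apply (F : MvPowerSeries ι ℂ) (d : ℕ) (t : ι → ℂ) :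
    (toMultilinear F d fun _ => t) = ∑ p : degreeFinset ι d, coeff p.1 F * monom p t := by
  simp [toMultilinear, monomMultilinear_apply]

/-- Exponents sorted by total degree. -/
noncomputable def sigmaDegreeEquiv (ι : Type*) [Fintype ι] :
    (Σ d, degreeFinset ι d) ≃ (ι →₀ ℕ) where
  toFun x := x.2
  invFun p := ⟨p.degree, p, mem_degreeFinset.2 rfl⟩
  left_inv := by
    rintro ⟨d, p, hp⟩
    obtain rfl := mem_degreeFinset.1 hp
    rfl
  right_inv _ := rfl

theorem HasExpansion.hasFPowerSeriesAt {f : (ι → ℂ) → ℂ} {F : MvPowerSeries ι ℂ}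
    (h : HasExpansion f F) : HasFPowerSeriesAt f (toMultilinear F) 0 := by
  obtain ⟨r, hr, h1, h2⟩ := h
  lift r to NNReal using hr.le
  refine ⟨r, ?_, by exact_mod_cast hr, fun {t} ht => ?_⟩
  · refine FormalMultilinearSeries.le_radius_of_summable _ ?_
    have h3 : Summable fun x : Σ d, degreeFinset ι d => ‖coeff x.2.1 F‖ * (r : ℝ) ^ x.1 := by
      refine ((sigmaDegreeEquiv ι).summable_iff.2 h1).congr fun x => ?_
      simp only [Function.comp, sigmaDegreeEquiv, Equiv.coe_fn_mk]
      rw [mem_degreeFinset.1 x.2.2]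
    have h4 := (summable_sigma_of_nonneg (fun _ => by positivity)).1 h3
    refine Summable.of_nonneg_of_le (fun _ => by positivity) (fun d => ?_) h4.2
    rw [tsum_fintype]
    dsimp only
    rw [← Finset.sum_mul]
    gcongr
    refine (norm_sum_le _ _).trans (Finset.sum_le_sum fun p _ => ?_)
    rw [norm_smul]
    exact mul_le_of_le_one_right (norm_nonneg _) (norm_monomMultilinear_le d p)
  · have ht' : ‖t‖ ≤ r := by
      rw [Metric.mem_eball, edist_zero_right] at ht
      have : ‖t‖₊ < r := by exact_mod_cast ht
      exact_mod_cast this.le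
    rw [zero_add]
    have h3 := (sigmaDegreeEquiv ι).hasSum_iff.2 (h2 t ht')
    convert! h3.sigma fun d => hasSum_fintype _ using 2 with d
    rw [toMultilinear_apply]
    rfl

theorem HasExpansion.analyticAt {f : (ι → ℂ) → ℂ} {F : MvPowerSeries ι ℂ}
    (h : HasExpansion f F) : AnalyticAt ℂ f 0 := h.hasFPowerSeriesAt.analyticAt

/-- The expansion of a vanishing germ is zero: its homogeneous parts vanish as functions, hence
as polynomials. -/
theorem HasExpansion.eq_zero {f : (ι → ℂ) → ℂ} {F : MvPowerSeries ι ℂ}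
    (h : HasExpansion f F) (hf : f =ᶠ[𝓝 0] 0) : F = 0 := by
  classical
  ext p
  have h1 := (h.congr hf).hasFPowerSeriesAt.apply_eq_zero p.degree
  let Q : MvPolynomial ι ℂ :=
    ∑ q : degreeFinset ι p.degree, MvPolynomial.monomial q.1 (coeff q.1 F)
  have hQ : Q = 0 := by
    refine MvPolynomial.funext fun t => ?_
    have h2 := h1 t
    rw [toMultilinear_apply] at h2
    rw [map_zero, ← h2, map_sum]
    refine Finset.sum_congr rfl fun q _ => ?_
    rw [MvPolynomial.eval_monomial, monom, Finsupp.prod_fintype _ _ (by simp)]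
  have h3 := congrArg (MvPolynomial.coeff p) hQ
  rw [MvPolynomial.coeff_sum, Finset.sum_eq_single ⟨p, mem_degreeFinset.2 rfl⟩] at h3
  · simpa using h3
  · intro q _ hq
    rw [MvPolynomial.coeff_monomial, if_neg]
    exact fun h => hq (Subtype.ext h)
  · simp

theorem HasExpansion.eventuallyEq_zero {f : (ι → ℂ) → ℂ} (h : HasExpansion f 0) :
    f =ᶠ[𝓝 0] 0 := by
  obtain ⟨r, hr, -, h⟩ := h
  filter_upwards [Metric.closedBall_mem_nhds 0 hr] with t ht
  have := h t (by simpa using ht)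
  simp only [map_zero, zero_mul] at this
  exact this.unique hasSum_zero

theorem HasExpansion.eventuallyEq {f g : (ι → ℂ) → ℂ} {F : MvPowerSeries ι ℂ}
    (hf : HasExpansion f F) (hg : HasExpansion g F) : f =ᶠ[𝓝 0] g := by
  have := hf.sub hg
  rw [sub_self] at this
  filter_upwards [this.eventuallyEq_zero] with t ht
  exact sub_eq_zero.1 ht

theorem monom_content [DecidableEq ι] (x : Σ d, Fin d → ι) (t : ι → ℂ) :
    monom (content x) t = ∏ i, t (x.2 i) := by
  have : ∀ S : Finset (Fin x.1),
      monom (∑ i ∈ S, Finsupp.single (x.2 i) 1) t = ∏ i ∈ S, t (x.2 i) := by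
    intro S
    induction S using Finset.induction_on with
    | empty => simp [monom_zero]
    | insert a S ha ih =>
      rw [Finset.sum_insert ha, Finset.prod_insert ha, monom_add, monom_single, ih]
  exact this _

theorem multilinear_diag_eq_sum [DecidableEq ι] {d : ℕ} (M : (ι → ℂ) [×d]→L[ℂ] ℂ) (t : ι → ℂ) :
    (M fun _ => t) = ∑ w : Fin d → ι, M (fun i => Pi.single (w i) 1) * ∏ i, t (w i) := by
  have ht : t = ∑ s, t s • (Pi.single s 1 : ι → ℂ) := by
    ext s
    simp [Finset.sum_apply, Pi.single_apply]
  conv_lhs => rw [ht]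
  have := M.toMultilinearMap.map_sum (fun (_ : Fin d) s => t s • (Pi.single s 1 : ι → ℂ))
  refine this.trans (Finset.sum_congr rfl fun w _ => ?_)
  rw [MultilinearMap.map_smul_univ, smul_eq_mul, mul_comm]
  rfl

/-- An analytic germ has a multi-index expansion. The coefficient of `t ^ p` collects the values of
the multilinear Taylor terms on the words of basis vectors that spell `t ^ p`. -/
theorem exists_hasExpansion {f : (ι → ℂ) → ℂ} (hf : AnalyticAt ℂ f 0) :
    ∃ F, HasExpansion f F := by
  classical
  obtain ⟨P, R, hP⟩ := hf
  obtain ⟨r, hr0, hrR⟩ := ENNReal.lt_iff_exists_nnreal_btwn.1 hP.r_pos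
  have hr0 : (0 : ℝ) < r := by exact_mod_cast hr0
  obtain ⟨K, hK, hPK⟩ := P.norm_mul_pow_le_of_lt_radius (hrR.trans_le hP.r_le)
  set N : ℝ := (Fintype.card ι : ℝ)
  -- There are `N ^ d` words of length `d`; this radius leaves the geometric series of ratio `1/2`.
  set ρ : ℝ := r / (2 * (N + 1)) with hρ
  have hN : 0 ≤ N := Nat.cast_nonneg _
  have hρ0 : 0 < ρ := by positivity
  have hρr : ρ < r := by
    rw [hρ, div_lt_iff₀ (by positivity)]
    nlinarith
  have hNρ : N * ρ ≤ r * (1 / 2) := by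
    rw [hρ, mul_div_assoc', div_le_iff₀ (by positivity)]
    nlinarith
  let c : (Σ d, Fin d → ι) → ℂ := fun x => P x.1 fun i => Pi.single (x.2 i) 1
  have hc : ∀ x, ‖c x‖ ≤ ‖P x.1‖ := fun x => by
    refine ((P x.1).le_opNorm _).trans (mul_le_of_le_one_right (norm_nonneg _) ?_)
    refine Finset.prod_le_one (fun _ _ => norm_nonneg _) fun i _ => ?_
    simp [Pi.norm_single]
  have hsum : Summable fun x => ‖c x‖ * ρ ^ x.1 := by
    refine (summable_sigma_of_nonneg (fun _ => by positivity)).2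
      ⟨fun d => (hasSum_fintype _).summable, ?_⟩
    refine Summable.of_nonneg_of_le (fun d => tsum_nonneg fun _ => by positivity) (fun d => ?_)
      (summable_geometric_two.mul_left K)
    rw [tsum_fintype]
    calc ∑ w : Fin d → ι, ‖c ⟨d, w⟩‖ * ρ ^ d ≤ ∑ w : Fin d → ι, ‖P d‖ * ρ ^ d := by
          gcongr with w; exact hc ⟨d, w⟩
      _ = ‖P d‖ * (N * ρ) ^ d := by
          simp [N, mul_pow]; ring
      _ ≤ ‖P d‖ * (r * (1 / 2)) ^ d := by gcongr
      _ = (‖P d‖ * r ^ d) * (1 / 2) ^ d := by rw [mul_pow, mul_assoc]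
      _ ≤ K * (1 / 2) ^ d := by gcongr; exact hPK d
  have hsum' : Summable fun y : Σ p, {x // content x = p} =>
      ‖c y.2.1‖ * ρ ^ y.2.1.1 := (Equiv.sigmaFiberEquiv content).summable_iff.2 hsum
  let F : MvPowerSeries ι ℂ := fun p => ∑' x : {x // content x = p}, c x.1
  have hF : ∀ p, coeff p F = ∑' x : {x // content x = p}, c x.1 := fun p => rfl
  have hcs : ∀ p : ι →₀ ℕ, Summable fun x : {x // content x = p} => ‖c x.1‖ := fun p => by
    have h := hsum'.sigma_factor p
    have : ∀ x : {x // content x = p}, ‖c x.1‖ * ρ ^ x.1.1 = ‖c x.1‖ * ρ ^ p.degree := by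
      rintro ⟨x, rfl⟩
      rw [degree_content]
    simp only [this] at h
    exact (summable_mul_right_iff (by positivity)).1 h
  refine ⟨F, ρ, hρ0, ?_, fun t ht => ?_⟩
  · have h := ((summable_sigma_of_nonneg (fun _ => by positivity)).1 hsum').2
    refine Summable.of_nonneg_of_le (fun _ => by positivity) (fun p => ?_) h
    have : ∀ x : {x // content x = p}, ‖c x.1‖ * ρ ^ x.1.1 = ‖c x.1‖ * ρ ^ p.degree := by
      rintro ⟨x, rfl⟩
      rw [degree_content]
    simp only [this, tsum_mul_right]
    gcongr
    rw [hF]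
    exact norm_tsum_le_tsum_norm (hcs p)
  · have hS : Summable fun x => c x * monom (content x) t := by
      refine Summable.of_norm_bounded hsum fun x => ?_
      rw [norm_mul]
      gcongr
      exact (norm_monom_le _ ht).trans_eq (by rw [degree_content])
    have h1 : HasSum (fun x => c x * monom (content x) t) (f t) := by
      have h2 := hS.hasSum.sigma fun d => hasSum_fintype _
      have h3 : HasSum (fun d => P d fun _ => t) (f t) := by
        have := hP.hasSum (y := t) (by
          rw [Metric.mem_eball, edist_zero_right]
          refine lt_trans ?_ hrR
          have : ‖t‖₊ < r := by exact_mod_cast ht.trans_lt hρr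
          exact_mod_cast this)
        simpa using this
      have h4 : (fun d => ∑ w : Fin d → ι, c ⟨d, w⟩ * monom (content ⟨d, w⟩) t)
          = fun d => P d fun _ => t := by
        ext d
        rw [multilinear_diag_eq_sum]
        exact Finset.sum_congr rfl fun w _ => by rw [monom_content]
      rw [h4] at h2
      rw [← h2.unique h3]
      exact hS.hasSum
    have h5 := (Equiv.sigmaFiberEquiv content).hasSum_iff.2 h1
    refine h5.sigma fun p => ?_
    rw [hF]
    have := ((hcs p).of_norm.hasSum).mul_right (monom p t)
    convert! this using 2 with x
    simp [Equiv.sigmaFiberEquiv, x.2]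

/-! ### Termwise logarithmic differentiation -/

/-- The derivative of a monomial along the `s`-th coordinate line, multiplied by `t_s`. -/
theorem mul_deriv_monom [DecidableEq ι] (p : ι →₀ ℕ) (t : ι → ℂ) (s : ι) :
    Differentiable ℂ (fun x : ℂ => monom p (t + x • Pi.single s 1)) ∧
    t s * deriv (fun x : ℂ => monom p (t + x • Pi.single s 1)) 0 = p s * monom p t := by
  have h1 : (fun x : ℂ => monom p (t + x • Pi.single s 1))
      = fun x => (t s + x) ^ p s * ∏ a ∈ Finset.univ.erase s, t a ^ p a := by
    ext x
    rw [monom, ← Finset.mul_prod_erase _ _ (Finset.mem_univ s)]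
    congr 1
    · simp
    · refine Finset.prod_congr rfl fun a ha => ?_
      simp [Finset.ne_of_mem_erase ha]
  rw [h1]
  refine ⟨by fun_prop, ?_⟩
  have h2 : HasDerivAt (fun x : ℂ => (t s + x) ^ p s * ∏ a ∈ Finset.univ.erase s, t a ^ p a)
      (p s * (t s + 0) ^ (p s - 1) * 1 * ∏ a ∈ Finset.univ.erase s, t a ^ p a) 0 :=
    (((hasDerivAt_id (0 : ℂ)).const_add (t s)).pow (p s)).mul_const _
  rw [h2.deriv, monom, ← Finset.mul_prod_erase _ _ (Finset.mem_univ s)]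
  rcases Nat.eq_zero_or_pos (p s) with h | h
  · simp [h]
  · conv_rhs => rw [← Nat.sub_add_cancel h]
    rw [pow_succ, Nat.sub_add_cancel h]
    ring

/-- Termwise differentiation. Halving the radius absorbs the factor `p_s ≤ 2 ^ |p|`. -/
theorem HasExpansion.eulerDeriv [DecidableEq ι] {f : (ι → ℂ) → ℂ} {F : MvPowerSeries ι ℂ}
    (h : HasExpansion f F) (s : ι) :
    HasExpansion (fun t => t s * fderiv ℂ f t (Pi.single s 1)) (eulerDeriv s F) := by
  have han := h.analyticAt.eventually_analyticAt
  refine .of_eventually ?_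
  obtain ⟨R, hR, h1, h2⟩ := h
  filter_upwards [eventually_nhdsGT_forall_norm_le han,
    Ioc_mem_nhdsGT (by positivity : 0 < R / 2)] with r h3 hr
  have hr0 := hr.1
  refine ⟨?_, fun t ht => ?_⟩
  · refine Summable.of_nonneg_of_le (fun _ => by positivity) (fun p => ?_) h1
    rw [coeff_eulerDeriv, norm_mul, Complex.norm_natCast, mul_comm (p s : ℝ), mul_assoc]
    gcongr
    have hps : (p s : ℝ) ≤ 2 ^ p.degree := by
      exact_mod_cast (Finsupp.le_degree s p).trans Nat.lt_two_pow_self.le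
    calc (p s : ℝ) * r ^ p.degree ≤ 2 ^ p.degree * (R / 2) ^ p.degree := by
          gcongr; exact hr.2
      _ = R ^ p.degree := by rw [← mul_pow]; congr 1; ring
  · have hb : ∀ x ∈ Metric.ball (0 : ℂ) r, ‖t + x • (Pi.single s 1 : ι → ℂ)‖ ≤ R := fun x hx => by
      refine (norm_add_le _ _).trans ?_
      rw [norm_smul, Pi.norm_single, norm_one, mul_one]
      have : ‖x‖ < r := by simpa using hx
      linarith [hr.2]
    have h4 := Complex.hasSum_deriv_of_summable_norm (z := 0) (U := Metric.ball 0 r)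
      (F := fun p x => coeff p F * monom p (t + x • Pi.single s 1)) h1
      (fun p => ((mul_deriv_monom p t s).1.const_mul _).differentiableOn) Metric.isOpen_ball
      (fun p x hx => by
        rw [norm_mul]
        gcongr
        exact norm_monom_le p (hb x hx)) (Metric.mem_ball_self hr0)
    have h5 : deriv (fun x : ℂ => ∑' p, coeff p F * monom p (t + x • Pi.single s 1)) 0
        = fderiv ℂ f t (Pi.single s 1) := by
      rw [← (h3 t ht).differentiableAt.lineDeriv_eq_fderiv, lineDeriv]
      refine Filter.EventuallyEq.deriv_eq ?_
      filter_upwards [Metric.ball_mem_nhds (0 : ℂ) hr0] with x hx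
      exact (h2 _ (hb x hx)).tsum_eq
    rw [h5] at h4
    convert! h4.mul_left (t s) using 2 with p
    rw [coeff_eulerDeriv, deriv_const_mul _ ((mul_deriv_monom p t s).1 0), mul_left_comm,
      (mul_deriv_monom p t s).2]
    ring

end Analytic

/-! ### Weights avoiding resonances -/

/-- Countably many non-zero vectors are all detected by one positive real weight: take the
weights to be the powers of a number `x > 0` that is a root of none of the polynomials
`∑ v_s x ^ s`. -/
theorem exists_pos_weights {m : ℕ} {J : Type*} [Countable J] (v : J → Fin m → ℂ)
    (hv : ∀ j, v j ≠ 0) :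
    ∃ w : Fin m → ℝ, (∀ s, 0 < w s) ∧ ∀ j, ∑ s, (w s : ℂ) * v j s ≠ 0 := by
  let Q : J → Polynomial ℂ := fun j => ∑ s : Fin m, Polynomial.monomial s (v j s)
  have hQ : ∀ j, Q j ≠ 0 := fun j h => hv j <| funext fun s => by
    have := congrArg (fun q => Polynomial.coeff q s) h
    simpa [Q, Polynomial.finsetSum_coeff, Polynomial.coeff_monomial, Fin.val_inj] using this
  have hfin : ∀ j, {x : ℝ | (Q j).eval (x : ℂ) = 0}.Finite := fun j => by
    refine ((Q j).roots.toFinset.finite_toSet.preimage Complex.ofReal_injective.injOn).subset ?_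
    intro x hx
    simpa [hQ j] using hx
  have hcount : (⋃ j, {x : ℝ | (Q j).eval (x : ℂ) = 0}).Countable :=
    Set.countable_iUnion fun j => (hfin j).countable
  have : ¬ Set.Ioi (0 : ℝ) ⊆ ⋃ j, {x : ℝ | (Q j).eval (x : ℂ) = 0} := fun h => by
    have h1 := (hcount.mono h).le_aleph0
    rw [Cardinal.mk_Ioi_real] at h1
    exact Cardinal.aleph0_lt_continuum.not_ge h1
  obtain ⟨x, hx0, hx⟩ := Set.not_subset.1 this
  refine ⟨fun s => x ^ (s : ℕ), fun s => pow_pos hx0 _, fun j h => hx ?_⟩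
  refine Set.mem_iUnion.2 ⟨j, ?_⟩
  rw [Set.mem_ofPred_eq, ← h, Polynomial.eval_finsetSum]
  refine Finset.sum_congr rfl fun s _ => ?_
  rw [Polynomial.eval_monomial]
  push_cast
  ring

theorem exists_pos_le_of_finite {α : Type*} {S : Set α} (hS : S.Finite) (f : α → ℝ)
    (hf : ∀ x ∈ S, 0 < f x) : ∃ c > 0, ∀ x ∈ S, c ≤ f x := by
  rcases S.eq_empty_or_nonempty with rfl | hne
  · exact ⟨1, one_pos, by simp⟩
  · obtain ⟨a, ha, h⟩ := S.exists_min_image f hS hne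
    exact ⟨f a, hf a ha, h⟩

/-- With positive weights there are no small divisors: `⟨w, p⟩` is large for all but finitely
many exponents `p`. -/
theorem exists_divisor_lower_bound {ι κ : Type*} [Fintype ι] [Finite κ] (w : ι → ℝ)
    (hw : ∀ s, 0 < w s) (l : κ → ℂ)
    (h : ∀ p : ι →₀ ℕ, p ≠ 0 → ∀ k, ∑ s, (w s : ℂ) * p s - l k ≠ 0) :
    ∃ c > 0, ∀ p : ι →₀ ℕ, p ≠ 0 → ∀ k, c ≤ ‖∑ s, (w s : ℂ) * p s - l k‖ := by
  classical
  have hfin : ∀ k, {p : ι →₀ ℕ | ‖∑ s, (w s : ℂ) * p s - l k‖ ≤ 1}.Finite := fun k => by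
    refine (Set.finite_Iic (Finsupp.equivFunOnFinite.symm
      fun s => ⌈(1 + ‖l k‖) / w s⌉₊)).subset fun p hp s => ?_
    have h1 : w s * p s ≤ ∑ s, w s * (p s : ℝ) :=
      Finset.single_le_sum (f := fun s => w s * (p s : ℝ))
        (fun s _ => mul_nonneg (hw s).le (Nat.cast_nonneg _)) (Finset.mem_univ s)
    have h2 : ∑ s, w s * (p s : ℝ) ≤ ‖∑ s, (w s : ℂ) * p s‖ := by
      have : ∑ s, (w s : ℂ) * p s = ((∑ s, w s * (p s : ℝ) : ℝ) : ℂ) := by push_cast; rfl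
      rw [this, Complex.norm_real]
      exact le_abs_self _
    have h3 : ‖∑ s, (w s : ℂ) * p s‖ ≤ 1 + ‖l k‖ := by
      have := norm_sub_norm_le (∑ s, (w s : ℂ) * p s) (l k)
      have hp : ‖∑ s, (w s : ℂ) * p s - l k‖ ≤ 1 := hp
      linarith
    have h4 : (p s : ℝ) ≤ (1 + ‖l k‖) / w s := by
      rw [le_div_iff₀ (hw s)]
      linarith
    exact_mod_cast h4.trans (Nat.le_ceil _)
  have hS : {x : (ι →₀ ℕ) × κ | x.1 ≠ 0 ∧ ‖∑ s, (w s : ℂ) * x.1 s - l x.2‖ ≤ 1}.Finite := by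
    refine (Set.finite_iUnion fun k => (hfin k).prod (Set.finite_singleton k)).subset ?_
    rintro ⟨p, k⟩ hx
    exact Set.mem_iUnion.2 ⟨k, hx.2, rfl⟩
  obtain ⟨c, hc, hcS⟩ := exists_pos_le_of_finite hS
    (fun x => ‖∑ s, (w s : ℂ) * x.1 s - l x.2‖) fun x hx => norm_pos_iff.2 (h _ hx.1 _)
  refine ⟨min c 1, by positivity, fun p hp k => ?_⟩
  by_cases h1 : ‖∑ s, (w s : ℂ) * p s - l k‖ ≤ 1
  · exact (min_le_left _ _).trans (hcS (p, k) ⟨hp, h1⟩)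
  · exact (min_le_right _ _).trans (not_le.1 h1).le

/-! ### The triangular recursion for the coefficients -/

section Formal

variable {ι n : Type*} [Fintype n]

theorem coeff_matrix_mul [DecidableEq ι] (H N : Matrix n n (MvPowerSeries ι ℂ)) (p : ι →₀ ℕ)
    (i j : n) : coeff p ((H * N) i j) = ∑ x ∈ Finset.HasAntidiagonal.antidiagonal p,
      ∑ l, coeff x.1 (H i l) * coeff x.2 (N l j) := by
  rw [Matrix.mul_apply, map_sum, Finset.sum_comm]
  exact Finset.sum_congr rfl fun l _ => coeff_mul _ _ _

theorem lt_of_mem_antidiagonal [DecidableEq ι] {p : ι →₀ ℕ} {x : (ι →₀ ℕ) × (ι →₀ ℕ)}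
    (hx : x ∈ Finset.HasAntidiagonal.antidiagonal p) (h : x.2 ≠ 0) : x.1 < p := by
  rw [← Finset.HasAntidiagonal.mem_antidiagonal.1 hx]
  exact lt_add_of_pos_right _ (pos_iff_ne_zero.2 h)

open Classical in
/-- The coefficients of the normalized solution `H` of `μ_p H_p = -(H N)_p`. The
condition `x.1 < p`, which makes the recursion well founded, omits only the term with `x.2 = 0`;
it vanishes when `N` has no constant term. -/
noncomputable def solutionCoeff [DecidableEq n] (N : Matrix n n (MvPowerSeries ι ℂ))
    (μ : (ι →₀ ℕ) → n → n → ℂ) (p : ι →₀ ℕ) : Matrix n n ℂ :=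
  if p = 0 then 1 else
    Matrix.of fun i j => -(μ p i j)⁻¹ * ∑ x ∈ Finset.HasAntidiagonal.antidiagonal p,
      if x.1 < p then ∑ l, solutionCoeff N μ x.1 i l * coeff x.2 (N l j) else 0
termination_by p
decreasing_by assumption

theorem exists_formal_solution [DecidableEq n] (N : Matrix n n (MvPowerSeries ι ℂ))
    (hN : ∀ i j, coeff 0 (N i j) = 0) (μ : (ι →₀ ℕ) → n → n → ℂ)
    (hμ : ∀ p, p ≠ 0 → ∀ i j, μ p i j ≠ 0) :
    ∃ H : Matrix n n (MvPowerSeries ι ℂ), (∀ i j, coeff 0 (H i j) = (1 : Matrix n n ℂ) i j) ∧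
      ∀ p, p ≠ 0 → ∀ i j, μ p i j * coeff p (H i j) = - coeff p ((H * N) i j) := by
  classical
  refine ⟨Matrix.of fun i j p => solutionCoeff N μ p i j, fun i j => ?_, fun p hp i j => ?_⟩
  · change solutionCoeff N μ 0 i j = _
    rw [solutionCoeff, if_pos rfl]
  · change μ p i j * solutionCoeff N μ p i j = _
    rw [solutionCoeff, if_neg hp, Matrix.of_apply, neg_mul, mul_neg,
      mul_inv_cancel_left₀ (hμ p hp i j), coeff_matrix_mul]
    congr 1
    refine Finset.sum_congr rfl fun x hx => ?_
    split_ifs with h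
    · rfl
    · have h0 : x.2 = 0 := by
        by_contra h0
        exact h (lt_of_mem_antidiagonal hx h0)
      simp [h0, hN]

/-- Uniqueness for the recursion: a solution without constant term vanishes. As `N` has no
constant term, the coefficient of degree `p` is determined by those of lower exponent. -/
theorem formal_solution_eq_zero (N Ψ : Matrix n n (MvPowerSeries ι ℂ))
    (hN : ∀ i j, coeff 0 (N i j) = 0) (μ : (ι →₀ ℕ) → n → n → ℂ)
    (hμ : ∀ p, p ≠ 0 → ∀ i j, μ p i j ≠ 0) (h0 : ∀ i j, coeff 0 (Ψ i j) = 0)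
    (hΨ : ∀ p, p ≠ 0 → ∀ i j, μ p i j * coeff p (Ψ i j) = - coeff p ((Ψ * N) i j)) : Ψ = 0 := by
  classical
  suffices h : ∀ p : ι →₀ ℕ, ∀ i j, coeff p (Ψ i j) = 0 by
    ext i j p
    simpa using h p i j
  intro p
  refine (WellFoundedRelation.wf (α := ι →₀ ℕ)).induction
    (C := fun p => ∀ i j, coeff p (Ψ i j) = 0) p fun p ih i j => ?_
  rcases eq_or_ne p 0 with rfl | hp
  · exact h0 i j
  have h1 : coeff p ((Ψ * N) i j) = 0 := by
    rw [coeff_matrix_mul]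
    refine Finset.sum_eq_zero fun x hx => Finset.sum_eq_zero fun l _ => ?_
    rcases eq_or_ne x.2 0 with h | h
    · rw [h, hN, mul_zero]
    · rw [ih x.1 (lt_of_mem_antidiagonal hx h), zero_mul]
  have h2 := hΨ p hp i j
  rw [h1, neg_zero] at h2
  exact (mul_eq_zero.1 h2).resolve_left (hμ p hp i j)

/-! ### Convergence of the formal solution -/

/-- A non-negative family satisfying `c a_p ≤ ∑_{q + q' = p} a_q b_{q'}`, with `b` convergent and
`b_0 = 0`, converges. On a small enough polydisc the sum of `b` is at most `c / 2`, so that the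
partial sums of `a` over boxes `{p ≤ P}` stay below `2 a_0`. -/
theorem exists_summable_of_convolution_bound [DecidableEq ι] (a b : (ι →₀ ℕ) → ℝ)
    (ha : ∀ p, 0 ≤ a p) (hb : ∀ p, 0 ≤ b p) (hb0 : b 0 = 0) {r c : ℝ} (hr : 0 < r) (hc : 0 < c)
    (hbr : Summable fun p => b p * r ^ p.degree)
    (hab : ∀ p, p ≠ 0 → c * a p ≤ ∑ x ∈ Finset.HasAntidiagonal.antidiagonal p, a x.1 * b x.2) :
    ∃ ρ > 0, Summable fun p => a p * ρ ^ p.degree := by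
  set S := ∑' p, b p * r ^ p.degree
  have hS : 0 ≤ S := tsum_nonneg fun p => mul_nonneg (hb p) (by positivity)
  set θ := min 1 (c / (2 * (S + 1)))
  have hθ : 0 < θ := by positivity
  have hθ1 : θ ≤ 1 := min_le_left _ _
  have hθS : θ * S ≤ c / 2 := by
    have h1 : θ ≤ c / (2 * (S + 1)) := min_le_right _ _
    calc θ * S ≤ c / (2 * (S + 1)) * (S + 1) := by gcongr; linarith
      _ = c / 2 := by field_simp
  refine ⟨θ * r, by positivity, ?_⟩
  set ρ := θ * r
  have hρ : 0 < ρ := by positivity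
  have hbρ : ∀ p, b p * ρ ^ p.degree ≤ θ * (b p * r ^ p.degree) := fun p => by
    rcases eq_or_ne p 0 with rfl | hp
    · simp [hb0]
    · have h1 : θ ^ p.degree ≤ θ :=
        pow_le_of_le_one hθ.le hθ1 (by rwa [Ne, Finsupp.degree_eq_zero_iff])
      have h2 : 0 ≤ b p * r ^ p.degree := mul_nonneg (hb p) (by positivity)
      rw [mul_pow]
      nlinarith [mul_le_mul_of_nonneg_right h1 h2]
  have ha' : ∀ p, 0 ≤ a p * ρ ^ p.degree := fun p => mul_nonneg (ha p) (by positivity)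
  have hb' : ∀ p, 0 ≤ b p * ρ ^ p.degree := fun p => mul_nonneg (hb p) (by positivity)
  have hbox : ∀ P : ι →₀ ℕ, ∑ p ∈ Finset.Iic P, b p * ρ ^ p.degree ≤ c / 2 := fun P => by
    refine (Finset.sum_le_sum fun p _ => hbρ p).trans ?_
    rw [← Finset.mul_sum]
    refine le_trans ?_ hθS
    gcongr
    exact hbr.sum_le_tsum _ fun p _ => mul_nonneg (hb p) (by positivity)
  have hmain : ∀ P : ι →₀ ℕ, ∑ p ∈ Finset.Iic P, a p * ρ ^ p.degree ≤ 2 * a 0 := fun P => by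
    have h1 : ∀ p, c * (a p * ρ ^ p.degree) ≤ (if p = 0 then c * a 0 else 0) +
        ∑ x ∈ Finset.HasAntidiagonal.antidiagonal p,
          (a x.1 * ρ ^ x.1.degree) * (b x.2 * ρ ^ x.2.degree) := fun p => by
      rcases eq_or_ne p 0 with rfl | hp
      · simp [hb0]
      · rw [if_neg hp, zero_add, ← mul_assoc]
        refine (mul_le_mul_of_nonneg_right (hab p hp) (by positivity)).trans_eq ?_
        rw [Finset.sum_mul]
        refine Finset.sum_congr rfl fun x hx => ?_
        rw [← Finset.HasAntidiagonal.mem_antidiagonal.1 hx, map_add, pow_add]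
        ring
    have h2 : ∑ p ∈ Finset.Iic P, ∑ x ∈ Finset.HasAntidiagonal.antidiagonal p,
        (a x.1 * ρ ^ x.1.degree) * (b x.2 * ρ ^ x.2.degree) ≤
        (∑ p ∈ Finset.Iic P, a p * ρ ^ p.degree) * ∑ p ∈ Finset.Iic P, b p * ρ ^ p.degree := by
      rw [Finset.sum_mul_sum, ← Finset.sum_product']
      refine le_trans (le_of_eq ?_) (Finset.sum_fiberwise_le_sum_of_sum_fiber_nonneg
        (s := Finset.Iic P ×ˢ Finset.Iic P) (t := Finset.Iic P) (g := fun x => x.1 + x.2)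
        fun p _ => Finset.sum_nonneg fun x _ => mul_nonneg (ha' _) (hb' _))
      refine Finset.sum_congr rfl fun p hp => Finset.sum_congr ?_ fun _ _ => rfl
      ext x
      simp only [Finset.HasAntidiagonal.mem_antidiagonal, Finset.mem_filter, Finset.mem_product,
        Finset.mem_Iic] at hp ⊢
      refine ⟨fun h => ⟨⟨?_, ?_⟩, h⟩, fun h => h.2⟩
      · exact (le_self_add.trans h.le).trans hp
      · exact (le_add_self.trans h.le).trans hp
    have h3 := Finset.sum_le_sum fun p (_ : p ∈ Finset.Iic P) => h1 p
    rw [← Finset.mul_sum, Finset.sum_add_distrib, Finset.sum_ite_eq', if_pos (by simp)] at h3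
    have h4 : 0 ≤ ∑ p ∈ Finset.Iic P, a p * ρ ^ p.degree := Finset.sum_nonneg fun p _ => ha' p
    have h5 := mul_le_mul_of_nonneg_left (hbox P) h4
    nlinarith
  refine summable_of_sum_le ha' (c := 2 * a 0) fun u => ?_
  refine (Finset.sum_le_sum_of_subset_of_nonneg (t := Finset.Iic (u.sup id)) (fun p hp => ?_)
    fun p _ _ => ha' p).trans (hmain _)
  exact Finset.mem_Iic.2 (Finset.le_sup (f := id) hp)

/-- The solution of the recursion converges when `N` does and the divisors `μ` are bounded below. -/
theorem exists_convergesAt_of_recursion (H N : Matrix n n (MvPowerSeries ι ℂ))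
    (hN : ∀ i j, coeff 0 (N i j) = 0) (μ : (ι →₀ ℕ) → n → n → ℂ) {c r : ℝ} (hc : 0 < c)
    (hμ : ∀ p, p ≠ 0 → ∀ i j, c ≤ ‖μ p i j‖)
    (hH : ∀ p, p ≠ 0 → ∀ i j, μ p i j * coeff p (H i j) = - coeff p ((H * N) i j))
    (hr : 0 < r) (hNr : ∀ i j, ConvergesAt (N i j) r) :
    ∃ ρ > 0, ∀ i j, ConvergesAt (H i j) ρ := by
  classical
  obtain ⟨ρ, hρ, h⟩ := exists_summable_of_convolution_bound
    (fun p => ∑ i, ∑ j, ‖coeff p (H i j)‖) (fun p => ∑ i, ∑ j, ‖coeff p (N i j)‖)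
    (fun p => by positivity) (fun p => by positivity) (by simp [hN]) hr hc
    (by
      simp only [Finset.sum_mul]
      exact summable_sum fun i _ => summable_sum fun j _ => hNr i j)
    (fun p hp => by
      calc c * ∑ i, ∑ j, ‖coeff p (H i j)‖ ≤ ∑ i, ∑ j, ‖coeff p ((H * N) i j)‖ := by
            rw [Finset.mul_sum]
            refine Finset.sum_le_sum fun i _ => ?_
            rw [Finset.mul_sum]
            refine Finset.sum_le_sum fun j _ => ?_
            rw [← norm_neg (coeff p ((H * N) i j)), ← hH p hp i j, norm_mul]
            gcongr
            exact hμ p hp i j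
        _ ≤ ∑ i, ∑ j, ∑ x ∈ Finset.HasAntidiagonal.antidiagonal p,
              ∑ l, ‖coeff x.1 (H i l)‖ * ‖coeff x.2 (N l j)‖ := by
            refine Finset.sum_le_sum fun i _ => Finset.sum_le_sum fun j _ => ?_
            rw [coeff_matrix_mul]
            refine (norm_sum_le _ _).trans (Finset.sum_le_sum fun x _ => ?_)
            refine (norm_sum_le _ _).trans (Finset.sum_le_sum fun l _ => ?_)
            rw [norm_mul]
        _ = ∑ x ∈ Finset.HasAntidiagonal.antidiagonal p,
              ∑ i, ∑ l, ‖coeff x.1 (H i l)‖ * ∑ j, ‖coeff x.2 (N l j)‖ := by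
            symm
            rw [Finset.sum_comm]
            refine Finset.sum_congr rfl fun i _ => ?_
            symm
            rw [Finset.sum_comm]
            refine Finset.sum_congr rfl fun x _ => ?_
            rw [Finset.sum_comm]
            simp only [Finset.mul_sum]
        _ ≤ _ := by
            refine Finset.sum_le_sum fun x _ => ?_
            rw [Finset.sum_mul]
            refine Finset.sum_le_sum fun i _ => ?_
            rw [Finset.sum_mul]
            refine Finset.sum_le_sum fun l _ => ?_
            refine mul_le_mul_of_nonneg_left ?_ (norm_nonneg _)
            exact Finset.single_le_sum (f := fun l => ∑ j, ‖coeff x.2 (N l j)‖)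
              (fun _ _ => by positivity) (Finset.mem_univ l))
  refine ⟨ρ, hρ, fun i j => Summable.of_nonneg_of_le (fun _ => by positivity) (fun p => ?_) h⟩
  gcongr
  exact (Finset.single_le_sum (f := fun j => ‖coeff p (H i j)‖)
    (fun _ _ => norm_nonneg _) (Finset.mem_univ j)).trans
    (Finset.single_le_sum (f := fun i => ∑ j, ‖coeff p (H i j)‖)
    (fun _ _ => by positivity) (Finset.mem_univ i))

end Formal

/-! ### Flatness makes one equation imply all -/

/-- Let `Ψ_a = D_a H - A_a H + H B_a` be the defects of the gauge equations. If `B` is flat and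
the weighted sum of the defects vanishes, each `Ψ_a` satisfies a homogeneous equation along the
weighted derivation `∑ w_b D_b`. -/
theorem weighted_derivation_defect {ι M : Type*} [Fintype ι] [Ring M] [Algebra ℂ M]
    (D : ι → M →ₗ[ℂ] M) (hmul : ∀ a x y, D a (x * y) = D a x * y + x * D a y)
    (hD : ∀ a b x, D a (D b x) = D b (D a x)) (A B : ι → M) (hDA : ∀ a b, D a (A b) = 0)
    (hA : ∀ a b, A a * A b = A b * A a)
    (hB : ∀ a b, D a (B b) - D b (B a) = B a * B b - B b * B a) (H : M) (w : ι → ℂ)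
    (Ψ : ι → M) (hΨ : ∀ a, Ψ a = D a H - A a * H + H * B a) (h : ∑ a, w a • Ψ a = 0) (a : ι) :
    ∑ b, w b • D b (Ψ a) = (∑ b, w b • A b) * Ψ a - Ψ a * ∑ b, w b • B b := by
  have hH : ∀ a, D a H = Ψ a + A a * H - H * B a := fun a => by rw [hΨ]; abel
  have key : ∀ b, D b (Ψ a) = D a (Ψ b) + A b * Ψ a - A a * Ψ b + Ψ b * B a - Ψ a * B b :=
    fun b => by
      have h1 := hB b a
      rw [sub_eq_iff_eq_add] at h1
      have h2 : D b (D a H) - D a (D b H) = 0 := sub_eq_zero.2 (hD b a H)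
      have h3 : D b (Ψ a) - D a (Ψ b) = A b * Ψ a - A a * Ψ b + Ψ b * B a - Ψ a * B b := by
        conv_lhs => rw [hΨ a, hΨ b]
        simp only [map_add, map_sub, hmul, hDA, zero_mul, zero_add]
        rw [h1, hD b a H, hH a, hH b]
        have h4 : A a * (A b * H) = A b * (A a * H) := by rw [← mul_assoc, hA, mul_assoc]
        simp only [mul_add, add_mul, mul_sub, sub_mul, mul_assoc, h4]
        abel
      rw [eq_add_of_sub_eq h3]
      abel
  have h1 : ∑ b, w b • D a (Ψ b) = 0 := by
    simpa using congrArg (D a) h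
  simp only [Finset.sum_mul, Finset.mul_sum, smul_mul_assoc, mul_smul_comm]
  have h2 : ∑ b, w b • (A a * Ψ b) = 0 := by
    simpa [Finset.mul_sum] using congrArg (A a * ·) h
  have h3 : ∑ b, w b • (Ψ b * B a) = 0 := by
    simpa [Finset.sum_mul] using congrArg (· * B a) h
  calc ∑ b, w b • D b (Ψ a)
      = ∑ b, w b • D a (Ψ b) + ∑ b, w b • (A b * Ψ a) - ∑ b, w b • (A a * Ψ b)
        + ∑ b, w b • (Ψ b * B a) - ∑ b, w b • (Ψ a * B b) := by
        simp only [key, smul_add, smul_sub, Finset.sum_add_distrib, Finset.sum_sub_distrib]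
    _ = _ := by rw [h1, h2, h3]; abel

section Gauge

variable {ι n : Type*}

/-- The logarithmic derivation `t_s ∂/∂t_s` applied entrywise. -/
noncomputable def matEulerDeriv (s : ι) :
    Matrix n n (MvPowerSeries ι ℂ) →ₗ[ℂ] Matrix n n (MvPowerSeries ι ℂ) :=
  (eulerDeriv s).toLinearMap.mapMatrix

theorem matEulerDeriv_apply (s : ι) (M : Matrix n n (MvPowerSeries ι ℂ)) (i j : n) :
    matEulerDeriv s M i j = eulerDeriv s (M i j) := rfl

variable [Fintype n]

theorem matEulerDeriv_mul (s : ι) (M N : Matrix n n (MvPowerSeries ι ℂ)) :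
    matEulerDeriv s (M * N) = matEulerDeriv s M * N + M * matEulerDeriv s N := by
  ext1 i j
  simp only [matEulerDeriv_apply, Matrix.mul_apply, Matrix.add_apply, map_sum,
    Derivation.leibniz, smul_eq_mul, Finset.sum_add_distrib]
  rw [add_comm]
  congr 1
  exact Finset.sum_congr rfl fun l _ => mul_comm _ _

/-- The connection matrix `t_s Ω_s = diag(d_s) + t_s T_s` along `t_s ∂/∂t_s`. -/
noncomputable def connMatrix [DecidableEq n] (d : ι → n → ℂ)
    (T : ι → Matrix n n (MvPowerSeries ι ℂ)) (s : ι) : Matrix n n (MvPowerSeries ι ℂ) :=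
  Matrix.diagonal (fun i => C (d s i)) + (X s : MvPowerSeries ι ℂ) • T s

/-- The power series form of the theorem: a flat connection whose residue vectors satisfy no
resonance with respect to the weights `w` has a convergent gauge transformation with value `1` at
the origin to its diagonal part. -/
theorem exists_convergent_gauge [Fintype ι] [DecidableEq n] (d : ι → n → ℂ)
    (T : ι → Matrix n n (MvPowerSeries ι ℂ))
    (hflat : ∀ a b, matEulerDeriv a (connMatrix d T b) - matEulerDeriv b (connMatrix d T a) =
      connMatrix d T a * connMatrix d T b - connMatrix d T b * connMatrix d T a)
    (w : ι → ℝ) (hw : ∀ s, 0 < w s)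
    (hres : ∀ p : ι →₀ ℕ, p ≠ 0 → ∀ i j, ∑ s, (w s : ℂ) * (p s - (d s i - d s j)) ≠ 0)
    {r : ℝ} (hr : 0 < r)
    (hT : ∀ s i j, ConvergesAt (X s * T s i j) r) :
    ∃ H : Matrix n n (MvPowerSeries ι ℂ),
      (∃ ρ > 0, ∀ i j, ConvergesAt (H i j) ρ) ∧
      (∀ i j, coeff 0 (H i j) = (1 : Matrix n n ℂ) i j) ∧
      ∀ a, matEulerDeriv a H =
        Matrix.diagonal (fun i => C (d a i)) * H - H * connMatrix d T a := by
  classical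
  set L : n → ℂ := fun i => ∑ s, (w s : ℂ) * d s i with hL
  set μ : (ι →₀ ℕ) → n → n → ℂ := fun p i j => ∑ s, (w s : ℂ) * p s - (L i - L j) with hμdef
  have hμ : ∀ p, p ≠ 0 → ∀ i j, μ p i j ≠ 0 := fun p hp i j => by
    convert hres p hp i j using 1
    simp only [hμdef, hL, mul_sub, Finset.sum_sub_distrib]
  obtain ⟨c, hc, hcμ⟩ := exists_divisor_lower_bound w hw (fun x : n × n => L x.1 - L x.2)
    fun p hp x => hμ p hp x.1 x.2
  set N : Matrix n n (MvPowerSeries ι ℂ) := ∑ s, (w s : ℂ) • (X s : MvPowerSeries ι ℂ) • T s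
    with hNdef
  have hNij : ∀ i j, N i j = ∑ s, (w s : ℂ) • (X s * T s i j) := fun i j => by
    simp only [hNdef, Matrix.sum_apply, Matrix.smul_apply, smul_eq_mul]
  have hN0 : ∀ i j, coeff 0 (N i j) = 0 := fun i j => by
    simp [hNij, coeff_zero_X_mul]
  have hNr : ∀ i j, ConvergesAt (N i j) r := fun i j => by
    have h1 : Summable fun p => ∑ s, ‖(w s : ℂ)‖ * (‖coeff p (X s * T s i j)‖ * r ^ p.degree) :=
      summable_sum fun s _ => (hT s i j).mul_left _
    refine Summable.of_nonneg_of_le (fun _ => by positivity) (fun p => ?_) h1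
    simp only [← mul_assoc]
    rw [← Finset.sum_mul, hNij, map_sum]
    gcongr
    refine (norm_sum_le _ _).trans_eq (Finset.sum_congr rfl fun s _ => ?_)
    rw [coeff_smul, norm_mul]
  obtain ⟨H, hH0, hH⟩ := exists_formal_solution N hN0 μ hμ
  refine ⟨H, exists_convergesAt_of_recursion H N hN0 μ hc (fun p hp i j => hcμ p hp (i, j)) hH
    hr hNr, hH0, ?_⟩
  set A : ι → Matrix n n (MvPowerSeries ι ℂ) := fun s => Matrix.diagonal fun i => C (d s i)
    with hA
  -- The weighted sum of the gauge equations, read off coefficient by coefficient.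
  have coeff_weighted : ∀ (M : Matrix n n (MvPowerSeries ι ℂ)) p i j,
      coeff p ((∑ s, (w s : ℂ) • matEulerDeriv s M - ((∑ s, (w s : ℂ) • A s) * M
        - M * ∑ s, (w s : ℂ) • connMatrix d T s)) i j)
      = μ p i j * coeff p (M i j) + coeff p ((M * N) i j) := fun M p i j => by
    have hAw : ∑ s, (w s : ℂ) • A s = Matrix.diagonal fun i => C (L i) := by
      ext1 i j
      simp only [hA, Matrix.sum_apply, Matrix.smul_apply, Matrix.diagonal_apply]
      split_ifs
      · simp [hL, smul_eq_C_mul]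
      · simp
    have hBw : ∑ s, (w s : ℂ) • connMatrix d T s = (Matrix.diagonal fun i => C (L i)) + N := by
      rw [← hAw, hNdef, ← Finset.sum_add_distrib]
      simp [connMatrix, hA]
    rw [hBw, hAw, mul_add, Matrix.sub_apply, Matrix.sub_apply, Matrix.add_apply,
      Matrix.diagonal_mul, Matrix.mul_diagonal, Matrix.sum_apply]
    simp only [Matrix.smul_apply, matEulerDeriv_apply, map_sub, map_add, map_sum, coeff_smul,
      coeff_eulerDeriv, coeff_C_mul, coeff_mul_C, hμdef, sub_mul, Finset.sum_mul]
    simp only [mul_assoc]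
    ring
  set Ψ : ι → Matrix n n (MvPowerSeries ι ℂ) := fun a =>
    matEulerDeriv a H - A a * H + H * connMatrix d T a with hΨ
  have hΨ0 : ∀ a i j, coeff 0 (Ψ a i j) = 0 := fun a i j => by
    have hc0 : ∀ i j, coeff 0 (connMatrix d T a i j) = coeff 0 (A a i j) := fun i j => by
      simp [connMatrix, hA]
    have h1 : coeff 0 ((H * connMatrix d T a) i j) = coeff 0 (A a i j) := by
      rw [coeff_matrix_mul]
      simp [hH0, hc0, Matrix.one_apply]
    have h2 : coeff 0 ((A a * H) i j) = coeff 0 (A a i j) := by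
      rw [coeff_matrix_mul]
      simp [hH0, Matrix.one_apply]
    simp only [hΨ]
    rw [Matrix.add_apply, Matrix.sub_apply, map_add, map_sub, h1, h2, matEulerDeriv_apply,
      coeff_eulerDeriv]
    simp
  have hsum : ∑ a, (w a : ℂ) • Ψ a = 0 := by
    have h1 : ∑ a, (w a : ℂ) • Ψ a = ∑ s, (w s : ℂ) • matEulerDeriv s H
        - ((∑ s, (w s : ℂ) • A s) * H - H * ∑ s, (w s : ℂ) • connMatrix d T s) := by
      simp only [hΨ, smul_add, smul_sub, Finset.sum_add_distrib, Finset.sum_sub_distrib,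
        Finset.sum_mul, Finset.mul_sum, smul_mul_assoc, mul_smul_comm]
      abel
    ext i j p
    rcases eq_or_ne p 0 with rfl | hp
    · simp only [Matrix.sum_apply, Matrix.smul_apply, map_sum, coeff_smul, hΨ0]
      simp
    · rw [h1, coeff_weighted, hH p hp]
      simp
  have hΨeq : ∀ a, Ψ a = 0 := fun a => by
    have h1 := weighted_derivation_defect matEulerDeriv matEulerDeriv_mul
      (fun a b M => by ext1 i j; exact eulerDeriv_comm _ _ _) A (connMatrix d T)
      (fun a b => by
        ext i j p
        simp only [matEulerDeriv_apply, hA, Matrix.diagonal_apply, coeff_eulerDeriv]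
        split_ifs
        · rcases eq_or_ne p 0 with rfl | hp
          · simp
          · simp [coeff_C, hp]
        · simp)
      (fun a b => by simp [hA, mul_comm]) hflat H (fun s => (w s : ℂ)) Ψ (fun _ => rfl) hsum a
    refine formal_solution_eq_zero N (Ψ a) hN0 μ hμ (hΨ0 a) fun p hp i j => ?_
    have h2 := coeff_weighted (Ψ a) p i j
    rw [← h1, sub_self, Matrix.zero_apply, map_zero] at h2
    exact eq_neg_of_add_eq_zero_left h2.symm
  intro a
  have := hΨeq a
  simp only [hΨ] at this
  rw [← sub_eq_zero, ← this]
  abel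

end Gauge

/-! ### Coordinates of logarithmic forms -/

/-- A germ vanishing off the coordinate hyperplanes vanishes: its expansion times `∏ t_s` is zero,
and the ring of power series has no zero divisors. -/
theorem analyticAt_eventually_eq_zero {ι : Type*} [Fintype ι] {f : (ι → ℂ) → ℂ}
    (hf : AnalyticAt ℂ f 0) (h : ∀ᶠ t in 𝓝 0, (∀ s, t s ≠ 0) → f t = 0) :
    ∀ᶠ t in 𝓝 0, f t = 0 := by
  classical
  obtain ⟨F, hF⟩ := exists_hasExpansion hf
  have hprod : ∀ S : Finset ι, HasExpansion (fun t : ι → ℂ => ∏ s ∈ S, t s) (∏ s ∈ S, X s) := by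
    intro S
    induction S using Finset.induction_on with
    | empty => simpa using hasExpansion_const (ι := ι) 1
    | insert a S ha ih =>
      simp only [Finset.prod_insert ha]
      exact (hasExpansion_coord a).mul ih
  have h0 : (∏ s, X s) * F = 0 := by
    refine ((hprod Finset.univ).mul hF).eq_zero ?_
    filter_upwards [h] with t ht
    by_cases h1 : ∀ s, t s ≠ 0
    · simp [ht h1]
    · push Not at h1
      obtain ⟨s, hs⟩ := h1
      simp [Finset.prod_eq_zero (Finset.mem_univ s) hs]
  have hF0 : F = 0 := (mul_eq_zero.1 h0).resolve_left
    (Finset.prod_ne_zero_iff.2 fun s _ hs => by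
      simpa [hs] using coeff_index_single_self_X (R := ℂ) s)
  exact (hF0 ▸ hF).eventuallyEq_zero

variable {m k n : ℕ}

theorem Form.val_eq_sum (ω : Form m 1) (t v : Fin m → ℂ) :
    ω.val t v = ∑ a, v a * ω.val t (Pi.single a 1) := by
  have h : ∀ v, ω.val t v
      = (ContinuousAlternatingMap.ofSubsingleton ℂ (Fin m → ℂ) ℂ (0 : Fin 1)).symm (ω t) v :=
    fun _ => rfl
  have hv : v = ∑ a, v a • (Pi.single a 1 : Fin m → ℂ) := by
    ext s
    simp [Finset.sum_apply, Pi.single_apply]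
  conv_lhs => rw [h, hv, map_sum]
  exact Finset.sum_congr rfl fun a _ => by rw [map_smul, h, smul_eq_mul]

theorem MatForm.val_eq_sum (Ω : MatForm m n) (t v : Fin m → ℂ) :
    Ω.val t v = ∑ a, v a • Ω.val t (Pi.single a 1) := by
  ext i j
  rw [Matrix.sum_apply]
  exact Form.val_eq_sum _ _ _

/-- The residues `a_i^s` along all coordinate hyperplanes, equal to `0` beyond the first `k`. -/
noncomputable def residues (A : Fin k → Matrix (Fin n) (Fin n) ℂ) (s : Fin m) (i : Fin n) : ℂ :=
  if h : (s : ℕ) < k then A ⟨s, h⟩ i i else 0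

theorem euler_val_single (hk : k ≤ m) (A : Fin k → Matrix (Fin n) (Fin n) ℂ)
    (hA : ∀ s, (A s).IsDiag) (t : Fin m → ℂ) (b : Fin m) :
    (euler hk A).val t (Pi.single b 1) = Matrix.diagonal fun i => (t b)⁻¹ * residues A b i := by
  ext i j
  have h1 : (euler hk A).val t (Pi.single b 1) i j = ∑ s : Fin k, A s i j *
      ((t (Fin.castLE hk s))⁻¹ * (Pi.single b 1 : Fin m → ℂ) (Fin.castLE hk s)) := by
    simp [MatForm.val, Form.val, euler, dlog, oneForm]
  rw [h1, Matrix.diagonal_apply]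
  split_ifs with hij
  · subst hij
    rw [residues]
    split_ifs with hb
    · rw [Finset.sum_eq_single ⟨b, hb⟩]
      · simp [mul_comm]
      · intro s _ hs
        rw [Pi.single_eq_of_ne, mul_zero, mul_zero]
        rintro rfl
        exact hs rfl
      · simp
    · rw [mul_zero]
      refine Finset.sum_eq_zero fun s _ => ?_
      rw [Pi.single_eq_of_ne, mul_zero, mul_zero]
      rintro rfl
      exact hb s.2
  · exact Finset.sum_eq_zero fun s _ => by rw [hA s hij, zero_mul]

theorem differentiableAt_dlog (hk : k ≤ m) (s : Fin k) {t : Fin m → ℂ}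
    (ht : t (Fin.castLE hk s) ≠ 0) : DifferentiableAt ℂ (dlog hk s) t := by
  have h : dlog hk s = fun t : Fin m → ℂ => (t (Fin.castLE hk s))⁻¹ •
      ContinuousAlternatingMap.ofSubsingleton ℂ (Fin m → ℂ) ℂ (0 : Fin 1)
        (ContinuousLinearMap.proj (Fin.castLE hk s)) := rfl
  rw [h]
  have h1 : DifferentiableAt ℂ (fun t : Fin m → ℂ => t (Fin.castLE hk s)) t := by fun_prop
  exact (h1.inv ht).smul_const _

theorem differentiableAt_euler (hk : k ≤ m) (A : Fin k → Matrix (Fin n) (Fin n) ℂ)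
    {t : Fin m → ℂ} (ht : ∀ s, t s ≠ 0) (i j : Fin n) :
    DifferentiableAt ℂ (euler hk A i j) t := by
  have h : euler hk A i j = ∑ s, A s i j • dlog hk s := rfl
  rw [h]
  exact DifferentiableAt.sum fun s _ => (differentiableAt_dlog hk s (ht _)).const_smul _

theorem analyticAt_val {ω : Form m 1} {t : Fin m → ℂ} (h : AnalyticAt ℂ ω t)
    (v : Fin m → ℂ) : AnalyticAt ℂ (fun t => ω.val t v) t :=
  (ContinuousAlternatingMap.apply ℂ (Fin m → ℂ) ℂ (fun _ : Fin 1 => v)).analyticAt _ |>.comp h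

theorem extDeriv_oneForm_apply {ω : Form m 1} {t : Fin m → ℂ} (h : DifferentiableAt ℂ ω t)
    (v w : Fin m → ℂ) : extDeriv ω t ![v, w] =
      fderiv ℂ (fun t => ω.val t w) t v - fderiv ℂ (fun t => ω.val t v) t w := by
  have h0 : Fin.removeNth (0 : Fin 2) ![v, w] = fun _ => w := by
    ext i; fin_cases i; rfl
  have h1 : Fin.removeNth (1 : Fin 2) ![v, w] = fun _ => v := by
    ext i; fin_cases i; rfl
  rw [extDeriv_apply h, Fin.sum_univ_two, h0, h1]
  simp [Form.val, sub_eq_add_neg]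

theorem matWedge_apply (Ω Θ : MatForm m n) (i j : Fin n) (t v w : Fin m → ℂ) :
    matWedge Ω Θ i j t ![v, w] =
      (Ω.val t v * Θ.val t w - Ω.val t w * Θ.val t v) i j := by
  have h : matWedge Ω Θ i j t = ∑ l, wedge (Ω i l) (Θ l j) t := by
    simp [matWedge]
  rw [h]
  simp only [ContinuousAlternatingMap.sum_apply, wedge_apply, Finset.sum_sub_distrib]
  rfl

/-- Multiplying by `t_b` turns the derivative of the coefficient `g` of a form along `t_b` into
the derivative of `t_b g`; the extra term of the product rule vanishes for `a ≠ b`. -/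
theorem fderiv_coord_mul {a b : Fin m} (hab : a ≠ b) {g B : (Fin m → ℂ) → ℂ} {t : Fin m → ℂ}
    (hg : DifferentiableAt ℂ g t) (hB : B =ᶠ[𝓝 t] fun t => t b * g t) :
    fderiv ℂ B t (Pi.single a 1) = t b * fderiv ℂ g t (Pi.single a 1) := by
  have h1 : HasFDerivAt (fun t : Fin m → ℂ => t b)
      (ContinuousLinearMap.proj (R := ℂ) (φ := fun _ : Fin m => ℂ) b) t := hasFDerivAt_apply b t
  rw [hB.fderiv_eq, HasFDerivAt.fderiv (f := fun t => t b * g t) (h1.mul hg.hasFDerivAt)]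
  simp [hab.symm]

theorem HasExpansion.matrix_mul {ι n : Type*} [Fintype ι] [Fintype n]
    {P Q : (ι → ℂ) → Matrix n n ℂ} {F G : Matrix n n (MvPowerSeries ι ℂ)}
    (hP : ∀ i j, HasExpansion (fun t => P t i j) (F i j))
    (hQ : ∀ i j, HasExpansion (fun t => Q t i j) (G i j)) (i j : n) :
    HasExpansion (fun t => (P t * Q t) i j) ((F * G) i j) := by
  simp only [Matrix.mul_apply]
  exact HasExpansion.sum _ fun l _ => (hP i l).mul (hQ l j)

theorem hasExpansion_diagonal {ι n : Type*} [Fintype ι] [DecidableEq n] (d : n → ℂ) (i j : n) :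
    HasExpansion (fun _ : ι → ℂ => Matrix.diagonal d i j)
      ((Matrix.diagonal fun i => C (d i) : Matrix n n (MvPowerSeries ι ℂ)) i j) := by
  simp only [Matrix.diagonal_apply]
  split_ifs
  · exact hasExpansion_const _
  · simpa using hasExpansion_const (ι := ι) 0

/-! ### The gauge equations as equations between power series -/

/-- The holomorphic matrix `t_s Ω_s`, where `Ω = ∑ Ω_s dt_s` is the form `Ω₀ + Θ`. -/
noncomputable def logMatrix (A : Fin k → Matrix (Fin n) (Fin n) ℂ) (Θ : MatForm m n) (s : Fin m)
    (t : Fin m → ℂ) : Matrix (Fin n) (Fin n) ℂ :=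
  Matrix.diagonal (residues A s) + t s • Θ.val t (Pi.single s 1)

theorem logMatrix_eq_smul_val (hk : k ≤ m) {A : Fin k → Matrix (Fin n) (Fin n) ℂ}
    (hA : ∀ s, (A s).IsDiag) (Θ : MatForm m n) {s : Fin m} {t : Fin m → ℂ} (hs : t s ≠ 0) :
    logMatrix A Θ s t = t s • (euler hk A + Θ).val t (Pi.single s 1) := by
  have h1 : (euler hk A + Θ).val t (Pi.single s 1) =
      (euler hk A).val t (Pi.single s 1) + Θ.val t (Pi.single s 1) := rfl
  rw [h1, euler_val_single hk A hA, smul_add, logMatrix, ← Matrix.diagonal_smul]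
  congr 2
  ext i
  simp [hs]

/-- The expansions of the entries of `t_s Ω_s` are those of the formal connection matrix. -/
theorem hasExpansion_logMatrix (A : Fin k → Matrix (Fin n) (Fin n) ℂ) (Θ : MatForm m n)
    {T : Fin m → Matrix (Fin n) (Fin n) (MvPowerSeries (Fin m) ℂ)}
    (hT : ∀ s i j, HasExpansion (fun t => Θ.val t (Pi.single s 1) i j) (T s i j))
    (s : Fin m) (i j : Fin n) :
    HasExpansion (fun t => logMatrix A Θ s t i j) (connMatrix (residues A) T s i j) := by
  exact (hasExpansion_diagonal _ i j).add ((hasExpansion_coord s).mul (hT s i j))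

theorem notMem_cross (hk : k ≤ m) {t : Fin m → ℂ} (ht : ∀ s, t s ≠ 0) : t ∉ cross hk := by
  simp [cross, Finset.prod_eq_zero_iff, ht]

/-- Flatness in logarithmic coordinates. -/
theorem formal_flatness (hk : k ≤ m) {A : Fin k → Matrix (Fin n) (Fin n) ℂ}
    (hA : ∀ s, (A s).IsDiag) {Θ : MatForm m n} (hΘ : Θ.Holomorphic)
    (hflat : Flat hk (euler hk A + Θ))
    {T : Fin m → Matrix (Fin n) (Fin n) (MvPowerSeries (Fin m) ℂ)}
    (hT : ∀ s i j, HasExpansion (fun t => Θ.val t (Pi.single s 1) i j) (T s i j))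
    (a b : Fin m) :
    matEulerDeriv a (connMatrix (residues A) T b) - matEulerDeriv b (connMatrix (residues A) T a) =
      connMatrix (residues A) T a * connMatrix (residues A) T b
        - connMatrix (residues A) T b * connMatrix (residues A) T a := by
  rcases eq_or_ne a b with rfl | hab
  · simp
  rw [← sub_eq_zero]
  ext1 i j
  have hB := hasExpansion_logMatrix A Θ hT
  have hexp := (((hB b i j).eulerDeriv a).sub ((hB a i j).eulerDeriv b)).sub
    ((HasExpansion.matrix_mul (hB a) (hB b) i j).sub (HasExpansion.matrix_mul (hB b) (hB a) i j))
  refine hexp.eq_zero (analyticAt_eventually_eq_zero hexp.analyticAt ?_)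
  have han : ∀ᶠ t in 𝓝 0, ∀ i j, AnalyticAt ℂ (Θ i j) t := by
    simp only [eventually_all]
    exact fun i j => (hΘ i j).eventually_analyticAt
  rw [Flat, eventually_nhdsWithin_iff] at hflat
  filter_upwards [hflat, han] with t ht hant ht0
  set Ω := euler hk A + Θ with hΩ
  have hdiff : ∀ i j, DifferentiableAt ℂ (Ω i j) t := fun i j =>
    (differentiableAt_euler hk A ht0 i j).add (hant i j).differentiableAt
  have h1 := congrArg (fun φ => φ ![Pi.single a 1, Pi.single b 1]) (ht (notMem_cross hk ht0) i j)
  rw [extDeriv_oneForm_apply (hdiff i j), matWedge_apply] at h1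
  have hval : ∀ v, DifferentiableAt ℂ (fun t => (Ω i j).val t v) t := fun v =>
    (hdiff i j).continuousAlternatingMap_apply_const _
  have hlog : ∀ s : Fin m, (fun t => logMatrix A Θ s t i j) =ᶠ[𝓝 t]
      fun t => t s * (Ω i j).val t (Pi.single s 1) := fun s => by
    filter_upwards [(continuous_apply s).continuousAt.eventually_ne (ht0 s)] with u hu
    rw [logMatrix_eq_smul_val hk hA Θ hu]
    rfl
  rw [fderiv_coord_mul hab (hval _) (hlog b), fderiv_coord_mul hab.symm (hval _) (hlog a),
    logMatrix_eq_smul_val hk hA Θ (ht0 a), logMatrix_eq_smul_val hk hA Θ (ht0 b), ← hΩ]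
  rw [Matrix.sub_apply] at h1
  simp only [smul_mul_assoc, mul_smul_comm, Matrix.smul_apply, smul_eq_mul]
  linear_combination t a * t b * h1

/-- Non-resonance means that no exponent of a monomial, other than `0`, equals a difference of
residue vectors. -/
theorem NonResonant.sub_ne_zero (hk : k ≤ m) {A : Fin k → Matrix (Fin n) (Fin n) ℂ}
    (hres : NonResonant A) {p : Fin m →₀ ℕ} (hp : p ≠ 0) (i j : Fin n) :
    (fun s => (p s : ℂ) - (residues A s i - residues A s j)) ≠ 0 := by
  intro h
  rcases eq_or_ne i j with rfl | hij
  · refine hp (Finsupp.ext fun s => ?_)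
    simpa using congrFun h s
  · refine hres i j hij fun s => ⟨p (Fin.castLE hk s), ?_⟩
    have := congrFun h (Fin.castLE hk s)
    simp only [residues, Fin.val_castLE, Fin.is_lt, dite_true, Pi.zero_apply, Fin.eta] at this
    rw [← sub_eq_zero.1 this]
    simp

/-- Off the crossing, a solution of the logarithmic equations solves the gauge equation in every
coordinate direction. Along `t_a` with `a` beyond the first `k` coordinates, the factor `t_a` is
cancelled by analyticity. -/
theorem fderiv_gauge (hk : k ≤ m) {A : Fin k → Matrix (Fin n) (Fin n) ℂ}
    (hA : ∀ s, (A s).IsDiag) {Θ : MatForm m n} (hΘ : Θ.Holomorphic)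
    {h : (Fin m → ℂ) → Matrix (Fin n) (Fin n) ℂ} (hh : ∀ i j, AnalyticAt ℂ (fun t => h t i j) 0)
    (a : Fin m) (i j : Fin n)
    (heq : ∀ᶠ t in 𝓝 0, t a * fderiv ℂ (fun t => h t i j) t (Pi.single a 1) =
      (Matrix.diagonal (residues A a) * h t - h t * logMatrix A Θ a t) i j) :
    ∀ᶠ t in 𝓝 0, t ∉ cross hk → fderiv ℂ (fun t => h t i j) t (Pi.single a 1) =
      ((euler hk A).val t (Pi.single a 1) * h t
        - h t * (euler hk A + Θ).val t (Pi.single a 1)) i j := by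
  have hne : ∀ t : Fin m → ℂ, t a ≠ 0 →
      t a * fderiv ℂ (fun t => h t i j) t (Pi.single a 1) =
        (Matrix.diagonal (residues A a) * h t - h t * logMatrix A Θ a t) i j →
      fderiv ℂ (fun t => h t i j) t (Pi.single a 1) =
        ((euler hk A).val t (Pi.single a 1) * h t
          - h t * (euler hk A + Θ).val t (Pi.single a 1)) i j := by
    intro t ht h1
    have h2 : Matrix.diagonal (residues A a) = t a • (euler hk A).val t (Pi.single a 1) := by
      rw [euler_val_single hk A hA, ← Matrix.diagonal_smul]
      congr 1
      ext i
      simp [ht]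
    rw [logMatrix_eq_smul_val hk hA Θ ht, h2, smul_mul_assoc, mul_smul_comm, ← smul_sub,
      Matrix.smul_apply, smul_eq_mul] at h1
    exact mul_left_cancel₀ ht h1
  by_cases hak : (a : ℕ) < k
  · filter_upwards [heq] with t ht htc
    refine hne t (fun h0 => htc ?_) ht
    exact Finset.prod_eq_zero (Finset.mem_univ (⟨a, hak⟩ : Fin k)) h0
  · have hE : ∀ t, (euler hk A).val t (Pi.single a 1) = 0 := fun t => by
      rw [euler_val_single hk A hA]
      simp [residues, hak]
    have han : AnalyticAt ℂ (fun t => fderiv ℂ (fun t => h t i j) t (Pi.single a 1) -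
        ((euler hk A).val t (Pi.single a 1) * h t
          - h t * (euler hk A + Θ).val t (Pi.single a 1)) i j) 0 := by
      have h1 : ∀ t, (euler hk A + Θ).val t (Pi.single a 1) = Θ.val t (Pi.single a 1) := fun t => by
        rw [← zero_add (Θ.val t (Pi.single a 1)), ← hE t]
        rfl
      simp only [hE, h1, zero_mul, zero_sub, Matrix.neg_apply, Matrix.mul_apply]
      refine AnalyticAt.sub ?_ (AnalyticAt.neg (Finset.analyticAt_fun_sum _ fun l _ =>
        (hh i l).mul (analyticAt_val (hΘ l j) _)))
      exact ((ContinuousLinearMap.apply ℂ ℂ (Pi.single a 1 : Fin m → ℂ)).analyticAt _).comp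
        (hh i j).fderiv
    have h2 := analyticAt_eventually_eq_zero han (by
      filter_upwards [heq] with t ht h0
      exact sub_eq_zero.2 (hne t (h0 a) ht))
    filter_upwards [h2] with t ht _
    exact sub_eq_zero.1 ht

end LogConn

theorem mainTheorem1 {m k n : ℕ} (hk : k ≤ m)
    (A : Fin k → Matrix (Fin n) (Fin n) ℂ) (hA : ∀ s, (A s).IsDiag)
    (hres : LogConn.NonResonant A)
    (Θ : LogConn.MatForm m n) (hΘ : Θ.Holomorphic)
    (hflat : LogConn.Flat hk (LogConn.euler hk A + Θ)) :
    LogConn.GaugeEquiv hk (LogConn.euler hk A + Θ) (LogConn.euler hk A) := by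
  open LogConn MvPowerSeries in
  have hT : ∀ s i j, ∃ F, HasExpansion (fun t => Θ.val t (Pi.single s 1) i j) F :=
    fun s i j => exists_hasExpansion (analyticAt_val (hΘ i j) _)
  choose T hT using hT
  let T' : Fin m → Matrix (Fin n) (Fin n) (MvPowerSeries (Fin m) ℂ) := fun s => Matrix.of (T s)
  have hT' : ∀ s i j, HasExpansion (fun t => Θ.val t (Pi.single s 1) i j) (T' s i j) := hT
  obtain ⟨w, hw, hwres⟩ := exists_pos_weights
    (J := {x : (Fin m →₀ ℕ) × Fin n × Fin n // x.1 ≠ 0})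
    (fun x s => (x.1.1 s : ℂ) - (residues A s x.1.2.1 - residues A s x.1.2.2))
    (fun x => hres.sub_ne_zero hk x.2 _ _)
  obtain ⟨r, hTr, hr⟩ : ∃ r, (∀ s i j, ConvergesAt (X s * T' s i j) r) ∧ 0 < r := by
    refine Eventually.exists (f := 𝓝[>] (0 : ℝ)) (Eventually.and ?_ self_mem_nhdsWithin)
    simp only [eventually_all]
    exact fun s i j => ((hasExpansion_coord s).mul (hT' s i j)).eventually.mono fun _ h => h.1
  obtain ⟨H, ⟨ρ, hρ, hHρ⟩, hH0, hH⟩ := exists_convergent_gauge (residues A) T'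
    (formal_flatness hk hA hΘ hflat hT') w hw (fun p hp i j => hwres ⟨(p, i, j), hp⟩) hr hTr
  let h : (Fin m → ℂ) → Matrix (Fin n) (Fin n) ℂ := fun t => Matrix.of fun i j =>
    ∑' p, coeff p (H i j) * monom p t
  have hexp : ∀ i j, HasExpansion (fun t => h t i j) (H i j) :=
    fun i j => (hHρ i j).hasExpansion hρ
  have h0 : h 0 = 1 := by
    ext i j
    rw [← hH0 i j]
    exact (hexp i j).apply_zero
  have hunit : ∀ᶠ t in 𝓝 0, IsUnit (h t) := by
    have hcont : ContinuousAt h 0 :=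
      continuousAt_pi.2 fun i => continuousAt_pi.2 fun j => (hexp i j).analyticAt.continuousAt
    have hdet : ContinuousAt (fun t => (h t).det) 0 :=
      (continuous_id.matrix_det.continuousAt (x := h 0)).comp hcont
    filter_upwards [hdet.eventually_ne (y := 0) (by simp [h0])] with t ht
    exact (Matrix.isUnit_iff_isUnit_det _).2 (isUnit_iff_ne_zero.2 ht)
  have hgauge : ∀ a i j, ∀ᶠ t in 𝓝 0, t ∉ cross hk →
      fderiv ℂ (fun t => h t i j) t (Pi.single a 1) = ((euler hk A).val t (Pi.single a 1) * h t
        - h t * (euler hk A + Θ).val t (Pi.single a 1)) i j := fun a i j => by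
    refine fderiv_gauge hk hA hΘ (fun i j => (hexp i j).analyticAt) a i j ?_
    have h1 := (hexp i j).eulerDeriv a
    have h2 := (HasExpansion.matrix_mul (hasExpansion_diagonal (residues A a)) hexp i j).sub
      (HasExpansion.matrix_mul hexp (hasExpansion_logMatrix A Θ hT' a) i j)
    rw [← matEulerDeriv_apply, hH] at h1
    exact h1.eventuallyEq h2
  refine ⟨h, fun i j => (hexp i j).analyticAt, hunit, ?_⟩
  rw [eventually_nhdsWithin_iff]
  simp only [← eventually_all] at hgauge
  filter_upwards [hunit, hgauge] with t hu ht htc v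
  have key : (euler hk A).val t v * h t = (dmat h).val t v
      + h t * (euler hk A + Θ).val t v := by
    have hd : ∀ a, (dmat h).val t (Pi.single a 1) = (euler hk A).val t (Pi.single a 1) * h t
        - h t * (euler hk A + Θ).val t (Pi.single a 1) := fun a => by
      ext i j
      exact ht a i j htc
    rw [MatForm.val_eq_sum _ t v, MatForm.val_eq_sum (dmat h) t v,
      MatForm.val_eq_sum (euler hk A + Θ) t v, Finset.sum_mul, Finset.mul_sum,
      ← Finset.sum_add_distrib]
    refine Finset.sum_congr rfl fun a _ => ?_
    rw [hd, smul_sub, smul_mul_assoc, mul_smul_comm, sub_add_cancel]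
  rw [← add_mul, ← key, mul_assoc,
    Matrix.mul_nonsing_inv _ ((Matrix.isUnit_iff_isUnit_det _).1 hu),
    mul_one]
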